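/- Let $n\ge 2$ and let $\omega_n$ be the volume of the unit ball of $\mathbb R^n$. For an open set $O\subseteq\mathbb R^n$ let $AC(O)$ be the class of all open sets $\Sigma\subseteq\mathbb R^n$ with smooth ($C^\infty$) boundary and compact closure $\bar\Sigma\subset O$. For a compact set $K\subset O$ let $$\operatorname{cap}_n(K;O)=\inf\Big\{\int_O|\nabla f|^n\,dV:\ f\in C_0^\infty(O),\ f\ge 1\text{ on }K\Big\}.$$ Fix a nonempty $\Omega\in AC(\mathbb R^n)$, that is, a nonempty bounded open set with smooth boundary. Write $V$ for Lebesgue measure and let $$\lambda_n(\Omega)=\inf\Big\{\frac{\int_\Omega|\nabla f|^n\,dV}{\int_\Omega|f|^n\,dV}:\ 0\ne f\in W_0^{1,n}(\Omega)\Big\},$$ where $W_0^{1,n}(\Omega)$ is the closure of $C_0^\infty(\Omega)$ under the norm $\|f\|_{L^n(\Omega)}+\|\nabla f\|_{L^n(\Omega)}$, and let $$E_n(\Omega)=\sup_{f\in C_0^\infty(\Omega),\ \int_\Omega|\nabla f|^n\,dV\le 1}\ \frac1{V(\Omega)}\int_\Omega\exp\Big((n^n\omega_n)^{\frac1{n-1}}|f|^{\frac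 n{n-1}}\Big)\,dV\in[1,\infty].$$ Consider the statements (i) $\displaystyle \lambda_n(\Omega)V(\Omega)\ge\frac{n^n\omega_n}{(n-1)!}\,E_n(\Omega)^{-1}$ (with $\infty^{-1}=0$); (ii) $\displaystyle \frac{V(\Sigma)}{V(\Omega)}\le\exp\Big(-\Big(\frac{n^n\omega_n}{\operatorname{cap}_n(\bar\Sigma;\Omega)}\Big)^{\frac1{n-1}}\Big)$ for all $\Sigma\in AC(\Omega)$ (the right-hand side is read as $0$ if the capacity is $0$, as it is for $\Sigma=\emptyset$); (iii) $E_n(\Omega)<\infty$. Then (ii) and (iii) are equivalent, and each of them implies (i). -/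

import Mathlib

open MeasureTheory TopologicalSpace
open scoped ENNReal ContDiff Distributions

noncomputable section

namespace FaberKrahn

/-- Euclidean space `ℝⁿ` with its Euclidean norm and Lebesgue measure. -/
abbrev Rn (n : ℕ) : Type := EuclideanSpace ℝ (Fin n)

/-- `ω_n`, the volume of the unit ball of `ℝⁿ`. -/
def unitBallVolume (n : ℕ) : ℝ := volume.real (Metric.ball (0 : Rn n) 1)

/-- A set `U` has smooth boundary: near each of its boundary points `U` is the sublevel set
`{φ < 0}` of a smooth function `φ` without critical points. -/
def HasSmoothBoundary {n : ℕ} (U : Set (Rn n)) : Prop :=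
  ∀ x ∈ frontier U, ∃ (W : Set (Rn n)) (φ : Rn n → ℝ),
    IsOpen W ∧ x ∈ W ∧ ContDiffOn ℝ ∞ φ W ∧ (∀ y ∈ W, fderiv ℝ φ y ≠ 0) ∧
      U ∩ W = {y ∈ W | φ y < 0}

/-- The admissible class `AC(O)`: all open sets with smooth boundary and compact closure
contained in `O`. -/
def AC {n : ℕ} (O : Opens (Rn n)) : Set (Opens (Rn n)) :=
  {S | HasSmoothBoundary (S : Set (Rn n)) ∧ IsCompact (closure (S : Set (Rn n))) ∧
    closure (S : Set (Rn n)) ⊆ O}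

/-- The `p`-capacity of a compact set `K ⊆ O` relative to `O`: the infimum of `∫_O |∇f|^p` over
all `f ∈ C_0^∞(O)` with `f ≥ 1` on `K`. -/
def cap {n : ℕ} (p : ℝ) (K : Set (Rn n)) (O : Opens (Rn n)) : ℝ≥0∞ :=
  ⨅ (f : 𝓓(O, ℝ)) (_ : ∀ x ∈ K, 1 ≤ f x), ∫⁻ x in (O : Set (Rn n)), ‖gradient f x‖ₑ ^ p

/-- `G` is the weak gradient of `f` on `Ω` (used for `f` and `G` that are `p`-integrable
on `Ω`). -/
def IsWeakGradient {n : ℕ} (Ω : Opens (Rn n)) (f : Rn n → ℝ) (G : Rn n → Rn n) : Prop :=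
  ∀ φ : 𝓓(Ω, ℝ), ∫ x in (Ω : Set (Rn n)), f x • gradient φ x =
    -∫ x in (Ω : Set (Rn n)), φ x • G x

/-- `f` belongs to `W_0^{1,p}(Ω)` and has weak gradient `G`: both are `p`-integrable on `Ω`, and
`f` is in the closure of `C_0^∞(Ω)` for the norm `‖f‖_p + ‖∇f‖_p`. -/
structure MemW0 {n : ℕ} (p : ℝ) (Ω : Opens (Rn n)) (f : Rn n → ℝ) (G : Rn n → Rn n) :
    Prop where
  memLp : MemLp f (ENNReal.ofReal p) (volume.restrict (Ω : Set (Rn n)))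
  memLp_grad : MemLp G (ENNReal.ofReal p) (volume.restrict (Ω : Set (Rn n)))
  weakGradient : IsWeakGradient Ω f G
  mem_closure : ∀ ε : ℝ≥0∞, 0 < ε → ∃ φ : 𝓓(Ω, ℝ),
    eLpNorm (fun x => f x - φ x) (ENNReal.ofReal p) (volume.restrict (Ω : Set (Rn n))) +
      eLpNorm (fun x => G x - gradient φ x) (ENNReal.ofReal p)
        (volume.restrict (Ω : Set (Rn n))) < ε

/-- The principal `p`-Laplacian eigenvalue `λ_p(Ω)`: the infimum of the Rayleigh quotients
`∫_Ω |∇f|^p / ∫_Ω |f|^p` over all `f ∈ W_0^{1,p}(Ω)` that are not almost everywhere zero. -/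
def principalEigenvalue {n : ℕ} (p : ℝ) (Ω : Opens (Rn n)) : ℝ≥0∞ :=
  ⨅ (f : Rn n → ℝ) (G : Rn n → Rn n) (_ : MemW0 p Ω f G)
    (_ : ¬ f =ᵐ[volume.restrict (Ω : Set (Rn n))] 0),
    (∫⁻ x in (Ω : Set (Rn n)), ‖G x‖ₑ ^ p) / ∫⁻ x in (Ω : Set (Rn n)), ‖f x‖ₑ ^ p

/-- The Moser–Trudinger quantity `E_n(Ω)`, a supremum with values in `[0, ∞]`. -/
def moserTrudinger {n : ℕ} (Ω : Opens (Rn n)) : ℝ≥0∞ :=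
  ⨆ (f : 𝓓(Ω, ℝ)) (_ : ∫⁻ x in (Ω : Set (Rn n)), ‖gradient f x‖ₑ ^ (n : ℝ) ≤ 1),
    (volume (Ω : Set (Rn n)))⁻¹ * ∫⁻ x in (Ω : Set (Rn n)), ENNReal.ofReal
      (Real.exp (|f x| ^ ((n : ℝ) / ((n : ℝ) - 1)) /
        ((n : ℝ) ^ n * unitBallVolume n) ^ (1 / (1 - (n : ℝ)))))

/-- The `(n,0)`-capacity–volume inequality on `Ω`. It is stated in `[0, ∞]`, so that it reads
`V(S)/V(Ω) ≤ exp(-∞) = 0` if the capacity of `S` is zero. -/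
def CapacityVolumeInequality {n : ℕ} (Ω : Opens (Rn n)) : Prop :=
  ∀ S ∈ AC Ω, volume (S : Set (Rn n)) / volume (Ω : Set (Rn n)) ≤
    EReal.exp (-(((ENNReal.ofReal ((n : ℝ) ^ n * unitBallVolume n) /
      cap (n : ℝ) (closure (S : Set (Rn n))) Ω) ^ (1 / ((n : ℝ) - 1)) : ℝ≥0∞) : EReal))

/-- The `n`-Faber–Krahn type inequality on `Ω`. -/
def FaberKrahnInequality {n : ℕ} (Ω : Opens (Rn n)) : Prop :=
  ENNReal.ofReal ((n : ℝ) ^ n * unitBallVolume n / ((n - 1).factorial : ℝ)) * (moserTrudinger Ω)⁻¹ ≤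
    principalEigenvalue (n : ℝ) Ω * volume (Ω : Set (Rn n))

end FaberKrahn

end

open scoped Pointwise

noncomputable section

namespace FaberKrahn

/-! ### The Prékopa–Leindler inequality -/

/-! The equivalence holds because (ii) and (iii) are both true on every nonempty bounded open set;
(i) then follows as well.

The engine is the sharp ring estimate `mul_pow_le_ringEnergy_mul_log_pow`: with `c = n^n ω_n`, the
`n`-energy of `f` on `{a < |f| < b}` is at least `c (b - a)^n / (log X)^(n-1)`, where `X` bounds the
ratio of the volumes of `{|f| > a}` and `{|f| ≥ b}`. It comes from isoperimetry: Prékopa–Leindler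
gives Brunn–Minkowski, hence a sharp bound for the `1`-energy of a ring; Hölder gives a rough bound
for the `n`-energy; cutting the ring at `2^k` levels and letting `k → ∞` turns this into the
logarithm.

For (ii), apply the estimate to a test function between the levels `0` and `1`. For (i), bound the
exponential below by the term of order `n - 1` of its series, scale, and pass to the closure
`W_0^{1,n}`.

For (iii), put `s(x) = log (V(Ω) / V{|f| ≥ |f(x)|})` and let `A` be the Moser exponent. The ring
estimate gives `A(f(x)) ≤ s(x)`, while `V{s ≥ j} ≤ V(Ω) e^(-j)`. This alone would allow a bounded
contribution from each of infinitely many unit intervals of `s`. Moser's gain,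
`almost_extremal_gap`, is that a deficit `s - A` of size about `k` occurs only for `O(k + 1)` such
intervals, each contributing `O(V(Ω) e^(-k))`; the sum over `k` converges. -/

lemma volume_add_volume_le_of_isCompact {K L C : Set ℝ} (hK : IsCompact K) (hL : IsCompact L)
    (hK' : K.Nonempty) (hL' : L.Nonempty) (h : ∀ a ∈ K, ∀ b ∈ L, a + b ∈ C) :
    volume K + volume L ≤ volume C := by
  obtain ⟨k, hk, hkmax⟩ := hK.exists_isGreatest hK'
  obtain ⟨l, hl, hlmin⟩ := hL.exists_isLeast hL'
  have e1 : volume ((fun x => l + x) '' K) = volume K := by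
    simp [Set.image_add_left]
  have e2 : volume ((fun x => k + x) '' L) = volume L := by
    simp [Set.image_add_left]
  -- With `k = max K` and `l = min L`, the translates `l + K` and `k + L` both lie in `C` and meet
  -- at most in `k + l`.
  have hdisj : AEDisjoint volume ((fun x => l + x) '' K) ((fun x => k + x) '' L) := by
    refine measure_mono_null (t := {k + l}) ?_ (by simp)
    rintro _ ⟨⟨a, ha, rfl⟩, ⟨b, hb, hab⟩⟩
    have h1 := hkmax ha
    have h2 := hlmin hb
    simp only at hab
    simp only [Set.mem_singleton_iff]
    linarith
  rw [← e1, ← e2, ← measure_union₀ ?_ hdisj]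
  · apply measure_mono
    rintro _ (⟨a, ha, rfl⟩ | ⟨b, hb, rfl⟩)
    · simpa [add_comm] using h a ha l hl
    · exact h k hk b hb
  · exact (hL.image (continuous_const_add k)).measurableSet.nullMeasurableSet

lemma volume_add_volume_le {A B C : Set ℝ} (hA : MeasurableSet A) (hB : MeasurableSet B)
    (hA' : A.Nonempty) (hB' : B.Nonempty) (h : ∀ a ∈ A, ∀ b ∈ B, a + b ∈ C) :
    volume A + volume B ≤ volume C := by
  obtain ⟨a₀, ha₀⟩ := hA'
  obtain ⟨b₀, hb₀⟩ := hB'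
  rw [hA.measure_eq_iSup_isCompact, hB.measure_eq_iSup_isCompact]
  simp_rw [iSup_and']
  refine ENNReal.biSup_add_biSup_le' ⟨∅, by simp⟩ ⟨∅, by simp⟩ ?_
  rintro K ⟨hKA, hK⟩ L ⟨hLB, hL⟩
  refine (add_le_add (measure_mono (Set.subset_insert a₀ K))
    (measure_mono (Set.subset_insert b₀ L))).trans ?_
  refine volume_add_volume_le_of_isCompact (hK.insert _) (hL.insert _) (by simp) (by simp) ?_
  intro a ha b hb
  exact h a (Set.insert_subset ha₀ hKA ha) b (Set.insert_subset hb₀ hLB hb)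

/-- Layer-cake formula plus one-dimensional Brunn–Minkowski for superlevel sets. Having the common
supremum `1` makes both sets nonempty for `t < 1` and empty for `t ≥ 1`; the sumset bound fails when
just one of them is empty. -/
lemma add_lintegral_le_lintegral_of_superlevel {F G H : ℝ → ℝ} {l : ℝ} (hl : 0 < l) (hl' : l < 1)
    (hF : Measurable F) (hG : Measurable G) (hH : Measurable H)
    (F0 : ∀ x, 0 ≤ F x) (G0 : ∀ x, 0 ≤ G x) (H0 : ∀ x, 0 ≤ H x)
    (F1 : ∀ x, F x ≤ 1) (G1 : ∀ x, G x ≤ 1)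
    (Fs : ∀ t < 1, ∃ x, t < F x) (Gs : ∀ t < 1, ∃ x, t < G x)
    (h : ∀ x y t, 0 < t → t < F x → t < G y → t < H (l * x + (1 - l) * y)) :
    ENNReal.ofReal l * (∫⁻ x, ENNReal.ofReal (F x)) +
      ENNReal.ofReal (1 - l) * (∫⁻ x, ENNReal.ofReal (G x)) ≤ ∫⁻ x, ENNReal.ofReal (H x) := by
  rw [lintegral_eq_lintegral_meas_lt _ (.of_forall F0) hF.aemeasurable,
    lintegral_eq_lintegral_meas_lt _ (.of_forall G0) hG.aemeasurable,
    lintegral_eq_lintegral_meas_lt _ (.of_forall H0) hH.aemeasurable,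
    ← lintegral_const_mul' _ _ (by simp), ← lintegral_const_mul' _ _ (by simp),
    ← lintegral_add_left]
  · refine setLIntegral_mono' measurableSet_Ioi fun t ht => ?_
    rcases lt_or_ge t 1 with ht1 | ht1
    · have s1 : ∀ (c : ℝ) (A : Set ℝ), 0 < c →
          ENNReal.ofReal c * volume A = volume ((fun x => c * x) '' A) := by
        intro c A hc
        have := Measure.addHaar_smul (volume : Measure ℝ) c A
        simp only [Module.finrank_self, pow_one, abs_of_pos hc] at this
        rw [← this]
        rfl
      rw [s1 _ _ hl, s1 _ _ (by linarith : 0 < 1 - l)]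
      have m1 : ∀ (c : ℝ) (A : Set ℝ), c ≠ 0 → MeasurableSet A →
          MeasurableSet ((fun x => c * x) '' A) := by
        intro c A hc hA
        exact (Homeomorph.mulLeft₀ c hc).measurableEmbedding.measurableSet_image.2 hA
      refine volume_add_volume_le (m1 _ _ hl.ne' (measurableSet_lt measurable_const hF))
        (m1 _ _ (by linarith) (measurableSet_lt measurable_const hG)) ?_ ?_ ?_
      · exact Set.Nonempty.image _ (Fs t ht1)
      · exact Set.Nonempty.image _ (Gs t ht1)
      · rintro _ ⟨x, hx, rfl⟩ _ ⟨y, hy, rfl⟩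
        exact h x y t ht hx hy
    · have e1 : {a | t < F a} = ∅ := by
        ext a; simpa using (F1 a).trans ht1
      have e2 : {a | t < G a} = ∅ := by
        ext a; simpa using (G1 a).trans ht1
      simp [e1, e2]
  · refine Measurable.const_mul ?_ _
    have : Antitone fun t : ℝ => volume {a | t < F a} := fun s t hst =>
      measure_mono fun x hx => lt_of_le_of_lt hst hx
    exact this.measurable

lemma geom_mean_le_arith_mean {l : ℝ} (hl : 0 < l) (hl' : l < 1) (a b : ℝ≥0∞) :
    a ^ l * b ^ (1 - l) ≤ ENNReal.ofReal l * a + ENNReal.ofReal (1 - l) * b := by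
  have h1 : 0 < 1 - l := by linarith
  rcases eq_or_ne a ⊤ with rfl | ha
  · simp [hl]
  rcases eq_or_ne b ⊤ with rfl | hb
  · simp [h1, hl']
  lift a to NNReal using ha
  lift b to NNReal using hb
  rw [← ENNReal.coe_rpow_of_nonneg _ hl.le, ← ENNReal.coe_rpow_of_nonneg _ h1.le]
  rw [ENNReal.ofReal, ENNReal.ofReal]
  norm_cast
  have := NNReal.geom_mean_le_arith_mean2_weighted l.toNNReal (1 - l).toNNReal a b
    (by rw [← Real.toNNReal_add hl.le h1.le]; simp)
  simpa [hl.le, h1.le, Real.coe_toNNReal] using this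

/-- Dividing `f` and `g` by their suprema reduces to the additive superlevel bound, and weighted
AM–GM returns to the product form. Boundedness keeps the suprema finite. -/
lemma prekopaLeindler_real_of_bounded {f g h : ℝ → ℝ≥0∞} {l : ℝ} (hl : 0 < l) (hl' : l < 1)
    (hf : Measurable f) (hg : Measurable g) (hh : Measurable h) {M : ℝ≥0∞} (hM : M ≠ ⊤)
    (hfM : ∀ x, f x ≤ M) (hgM : ∀ x, g x ≤ M)
    (H : ∀ x y, f x ^ l * g y ^ (1 - l) ≤ h (l * x + (1 - l) * y)) :
    (∫⁻ x, f x) ^ l * (∫⁻ x, g x) ^ (1 - l) ≤ ∫⁻ x, h x := by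
  have hl1 : 0 < 1 - l := by linarith
  set a := ⨆ x, f x with ha
  set b := ⨆ x, g x with hb
  have haT : a ≠ ⊤ := ne_top_of_le_ne_top hM (iSup_le hfM)
  have hbT : b ≠ ⊤ := ne_top_of_le_ne_top hM (iSup_le hgM)
  have hfa : ∀ x, f x ≤ a := le_iSup f
  have hgb : ∀ x, g x ≤ b := le_iSup g
  rcases eq_or_ne a 0 with ha0 | ha0
  · have : ∀ x, f x = 0 := fun x => le_antisymm (ha0 ▸ hfa x) bot_le
    simp [this, hl]
  rcases eq_or_ne b 0 with hb0 | hb0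
  · have : ∀ x, g x = 0 := fun x => le_antisymm (hb0 ▸ hgb x) bot_le
    simp [this, hl1]
  set c := a ^ l * b ^ (1 - l) with hc
  have hc0 : c ≠ 0 := by
    simp [hc, ha0, hb0, haT, hbT]
  have hcT : c ≠ ⊤ := ENNReal.mul_ne_top (ENNReal.rpow_ne_top_of_nonneg hl.le haT)
    (ENNReal.rpow_ne_top_of_nonneg hl1.le hbT)
  have fle : ∀ x, f x / a ≤ 1 := fun x => ENNReal.div_le_of_le_mul (by simpa using hfa x)
  have gle : ∀ x, g x / b ≤ 1 := fun x => ENNReal.div_le_of_le_mul (by simpa using hgb x)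
  have one : ∀ {u : ℝ≥0∞}, u ≤ 1 → u ≠ ⊤ := fun hu => ne_top_of_le_ne_top ENNReal.one_ne_top hu
  -- Capping `h / c` at `1` keeps it finite under `toReal`; nothing is lost, since only levels `t <
  -- 1` occur.
  have key := add_lintegral_le_lintegral_of_superlevel (F := fun x => (f x / a).toReal)
    (G := fun x => (g x / b).toReal) (H := fun x => (min 1 (h x / c)).toReal) hl hl'
    (hf.div_const _).ennreal_toReal (hg.div_const _).ennreal_toReal
    (measurable_const.min (hh.div_const _)).ennreal_toReal
    (fun _ => ENNReal.toReal_nonneg) (fun _ => ENNReal.toReal_nonneg)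
    (fun _ => ENNReal.toReal_nonneg)
    (fun x => ENNReal.toReal_le_of_le_ofReal zero_le_one (by simpa using fle x))
    (fun x => ENNReal.toReal_le_of_le_ofReal zero_le_one (by simpa using gle x)) ?_ ?_ ?_
  · simp only [ENNReal.ofReal_toReal (one (fle _)), ENNReal.ofReal_toReal (one (gle _)),
      ENNReal.ofReal_toReal (one (min_le_left _ _))] at key
    have k1 : ∫⁻ x, min 1 (h x / c) ≤ (∫⁻ x, h x) / c := by
      rw [ENNReal.div_eq_inv_mul, ← lintegral_const_mul _ hh]
      refine lintegral_mono fun x => (min_le_right _ _).trans ?_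
      rw [ENNReal.div_eq_inv_mul]
    have k2 : ∫⁻ x, f x / a = (∫⁻ x, f x) / a := by
      simp_rw [ENNReal.div_eq_inv_mul]; rw [lintegral_const_mul _ hf]
    have k3 : ∫⁻ x, g x / b = (∫⁻ x, g x) / b := by
      simp_rw [ENNReal.div_eq_inv_mul]; rw [lintegral_const_mul _ hg]
    rw [k2, k3] at key
    have := (geom_mean_le_arith_mean hl hl' _ _).trans (key.trans k1)
    rw [ENNReal.div_rpow_of_nonneg _ _ hl.le, ENNReal.div_rpow_of_nonneg _ _ hl1.le,
      ENNReal.le_div_iff_mul_le (.inl hc0) (.inl hcT)] at this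
    refine le_trans (le_of_eq ?_) this
    have ha1 : a ^ l ≠ 0 := by simp [ha0, haT]
    have hb1 : b ^ (1 - l) ≠ 0 := by simp [hb0, hbT]
    have ha2 : a ^ l ≠ ⊤ := ENNReal.rpow_ne_top_of_nonneg hl.le haT
    have hb2 : b ^ (1 - l) ≠ ⊤ := ENNReal.rpow_ne_top_of_nonneg hl1.le hbT
    rw [hc, mul_mul_mul_comm, ENNReal.div_mul_cancel ha1 ha2, ENNReal.div_mul_cancel hb1 hb2]
  · intro t ht
    rcases lt_or_ge t 0 with h0 | h0
    · exact ⟨0, h0.trans_le ENNReal.toReal_nonneg⟩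
    have : ENNReal.ofReal t * a < a := by
      conv_rhs => rw [← one_mul a]
      exact ENNReal.mul_lt_mul_left ha0 haT (by simpa using ht)
    obtain ⟨x, hx⟩ := lt_iSup_iff.1 (ha ▸ this)
    refine ⟨x, ?_⟩
    rw [← ENNReal.ofReal_lt_iff_lt_toReal h0 (one (fle x))]
    exact (ENNReal.lt_div_iff_mul_lt (.inl ha0) (.inl haT)).2 hx
  · intro t ht
    rcases lt_or_ge t 0 with h0 | h0
    · exact ⟨0, h0.trans_le ENNReal.toReal_nonneg⟩
    have : ENNReal.ofReal t * b < b := by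
      conv_rhs => rw [← one_mul b]
      exact ENNReal.mul_lt_mul_left hb0 hbT (by simpa using ht)
    obtain ⟨x, hx⟩ := lt_iSup_iff.1 (hb ▸ this)
    refine ⟨x, ?_⟩
    rw [← ENNReal.ofReal_lt_iff_lt_toReal h0 (one (gle x))]
    exact (ENNReal.lt_div_iff_mul_lt (.inl hb0) (.inl hbT)).2 hx
  · intro x y t ht hx hy
    rw [← ENNReal.ofReal_lt_iff_lt_toReal ht.le (one (fle x))] at hx
    rw [← ENNReal.ofReal_lt_iff_lt_toReal ht.le (one (gle y))] at hy
    rw [← ENNReal.ofReal_lt_iff_lt_toReal ht.le (one (min_le_left _ _)), lt_min_iff]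
    refine ⟨hx.trans_le (fle x), ?_⟩
    have e : ENNReal.ofReal t = ENNReal.ofReal t ^ l * ENNReal.ofReal t ^ (1 - l) := by
      rw [← ENNReal.rpow_add _ _ (by simpa using ht) (by simp)]; simp
    have : f x ^ l * g y ^ (1 - l) / c = (f x / a) ^ l * (g y / b) ^ (1 - l) := by
      rw [ENNReal.div_rpow_of_nonneg _ _ hl.le, ENNReal.div_rpow_of_nonneg _ _ hl1.le, hc,
        ENNReal.div_eq_inv_mul, ENNReal.div_eq_inv_mul, ENNReal.div_eq_inv_mul,
        ENNReal.mul_inv (.inr (ENNReal.rpow_ne_top_of_nonneg hl1.le hbT))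
          (.inl (ENNReal.rpow_ne_top_of_nonneg hl.le haT)), mul_mul_mul_comm]
    refine lt_of_lt_of_le ?_ (ENNReal.div_le_div_right (H x y) c)
    rw [this, e]
    exact ENNReal.mul_lt_mul (ENNReal.rpow_lt_rpow hx hl) (ENNReal.rpow_lt_rpow hy hl1)

theorem prekopaLeindler_real {f g h : ℝ → ℝ≥0∞} {l : ℝ} (hl : 0 < l) (hl' : l < 1)
    (hf : Measurable f) (hg : Measurable g) (hh : Measurable h)
    (H : ∀ x y, f x ^ l * g y ^ (1 - l) ≤ h (l * x + (1 - l) * y)) :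
    (∫⁻ x, f x) ^ l * (∫⁻ x, g x) ^ (1 - l) ≤ ∫⁻ x, h x := by
  have hl1 : 0 < 1 - l := by linarith
  rcases eq_or_ne (∫⁻ x, f x) 0 with hf0 | hf0
  · simp [hf0, hl]
  rcases eq_or_ne (∫⁻ x, g x) 0 with hg0 | hg0
  · simp [hg0, hl']
  have tr : ∀ {u : ℝ → ℝ≥0∞}, Measurable u → Filter.Tendsto
      (fun M : ℕ => ∫⁻ x, min (u x) M) Filter.atTop (nhds (∫⁻ x, u x)) := by
    intro u hu
    refine lintegral_tendsto_of_tendsto_of_monotone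
      (fun M => (hu.min measurable_const).aemeasurable) (.of_forall fun x => ?_)
      (.of_forall fun x => ?_)
    · intro i j hij
      exact min_le_min le_rfl (by exact_mod_cast hij)
    · have := (tendsto_const_nhds (x := u x)).min ENNReal.tendsto_nat_nhds_top
      simpa using this
  have T := ENNReal.Tendsto.mul ((tr hf).ennrpow_const l)
    (.inl (by simp [hf0, hl.not_gt])) ((tr hg).ennrpow_const (1 - l))
    (.inl (by simp [hg0, hl1.not_gt]))
  refine le_of_tendsto' T fun M => ?_
  refine prekopaLeindler_real_of_bounded hl hl' (hf.min measurable_const)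
    (hg.min measurable_const) hh (M := M) (by simp) (fun x => min_le_right _ _)
    (fun x => min_le_right _ _) fun x y => le_trans ?_ (H x y)
  gcongr <;> exact min_le_left _ _

/-- Induction on the dimension: the integrals over the slices satisfy the one-dimensional hypothesis
by the inductive one. -/
theorem prekopaLeindler_pi {n : ℕ} {f g h : (Fin n → ℝ) → ℝ≥0∞} {l : ℝ} (hl : 0 < l) (hl' : l < 1)
    (hf : Measurable f) (hg : Measurable g) (hh : Measurable h)
    (H : ∀ x y, f x ^ l * g y ^ (1 - l) ≤ h (l • x + (1 - l) • y)) :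
    (∫⁻ x, f x) ^ l * (∫⁻ x, g x) ^ (1 - l) ≤ ∫⁻ x, h x := by
  induction n with
  | zero =>
    have e : ∀ u : (Fin 0 → ℝ) → ℝ≥0∞, ∫⁻ x, u x = u 0 := by
      intro u
      rw [lintegral_unique]
      have : (volume : Measure (Fin 0 → ℝ)) Set.univ = 1 := by
        rw [volume_pi, Measure.pi_univ]; simp
      rw [this, mul_one]
      congr 1
      exact Subsingleton.elim _ _
    rw [e, e, e]
    simpa using H 0 0
  | succ n ih =>
    have mp := (volume_preserving_piFinSuccAbove (fun _ : Fin (n + 1) => ℝ) 0).symm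
    set e := (MeasurableEquiv.piFinSuccAbove (fun _ : Fin (n + 1) => ℝ) 0).symm
    have he : ∀ (c d x y : ℝ) (u v : Fin n → ℝ),
        e (c * x + d * y, c • u + d • v) = c • e (x, u) + d • e (y, v) := by
      intro c d x y u v
      ext i
      refine Fin.cases ?_ (fun j => ?_) i <;>
        simp [e, MeasurableEquiv.piFinSuccAbove, Fin.insertNthEquiv]
    have fub : ∀ {u : (Fin (n + 1) → ℝ) → ℝ≥0∞}, Measurable u →
        ∫⁻ x, u x = ∫⁻ x, ∫⁻ y, u (e (x, y)) := by
      intro u hu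
      rw [← mp.lintegral_comp hu, Measure.volume_eq_prod, lintegral_prod]
      exact (hu.comp e.measurable).aemeasurable
    rw [fub hf, fub hg, fub hh]
    refine prekopaLeindler_real hl hl' (hf.comp e.measurable).lintegral_prod_right'
      (hg.comp e.measurable).lintegral_prod_right' (hh.comp e.measurable).lintegral_prod_right'
      fun x y => ?_
    refine ih (hf.comp (e.measurable.comp measurable_prodMk_left))
      (hg.comp (e.measurable.comp measurable_prodMk_left))
      (hh.comp (e.measurable.comp measurable_prodMk_left)) fun u v => ?_
    have := H (e (x, u)) (e (y, v))
    rwa [← he] at this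

/-- The multiplicative form of the Brunn–Minkowski inequality. -/
theorem volume_rpow_mul_volume_rpow_le {n : ℕ} {A B C : Set (Rn n)} {l : ℝ} (hl : 0 < l)
    (hl' : l < 1) (hA : MeasurableSet A) (hB : MeasurableSet B) (hC : MeasurableSet C)
    (H : ∀ x ∈ A, ∀ y ∈ B, l • x + (1 - l) • y ∈ C) :
    volume A ^ l * volume B ^ (1 - l) ≤ volume C := by
  have hl1 : 0 < 1 - l := by linarith
  have mp := (EuclideanSpace.volume_preserving_symm_measurableEquiv_toLp (Fin n)).symm
  set e := (MeasurableEquiv.toLp 2 (Fin n → ℝ)).symm.symm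
  have he : ∀ {D : Set (Rn n)}, MeasurableSet D →
      volume D = ∫⁻ x, (e ⁻¹' D).indicator 1 x := by
    intro D hD
    rw [lintegral_indicator_one (e.measurable hD), mp.measure_preimage hD.nullMeasurableSet]
  rw [he hA, he hB, he hC]
  refine prekopaLeindler_pi hl hl' (measurable_one.indicator (e.measurable hA))
    (measurable_one.indicator (e.measurable hB)) (measurable_one.indicator (e.measurable hC))
    fun x y => ?_
  by_cases hx : x ∈ e ⁻¹' A
  · by_cases hy : y ∈ e ⁻¹' B
    · have : l • x + (1 - l) • y ∈ e ⁻¹' C := H _ hx _ hy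
      simp [hx, hy, this]
    · simp [hy, hl1]
  · simp [hx, hl]

/-! ### The Brunn–Minkowski inequality -/

lemma unitBallVolume_pos (n : ℕ) : 0 < unitBallVolume n :=
  ENNReal.toReal_pos (Metric.measure_ball_pos _ _ one_pos).ne' measure_ball_lt_top.ne

lemma volume_ball_eq {n : ℕ} {y r : ℝ} (hr : 0 < r) (hy : unitBallVolume n = y ^ n) :
    volume (Metric.ball (0 : Rn n) r) = ENNReal.ofReal ((r * y) ^ n) := by
  rw [Measure.addHaar_ball_of_pos _ _ hr, mul_pow, ENNReal.ofReal_mul (by positivity), ← hy,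
    unitBallVolume, ofReal_measureReal measure_ball_lt_top.ne]
  simp

/-- The Brunn–Minkowski inequality for a set and a ball. -/
theorem ofReal_add_pow_le_volume_thickening {n : ℕ} {K : Set (Rn n)} (hK : MeasurableSet K)
    {x y r : ℝ} (hx : 0 < x) (hy : 0 < y) (hr : 0 < r) (hKx : volume K = ENNReal.ofReal (x ^ n))
    (hyn : unitBallVolume n = y ^ n) :
    ENNReal.ofReal ((x + r * y) ^ n) ≤ volume (Metric.thickening r K) := by
  have hs : 0 < x + r * y := by positivity
  -- This weight makes `l⁻¹ • K` and the ball of radius `r / (1 - l)` equal in volume, so the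
  -- multiplicative inequality becomes the additive one.
  set l := x / (x + r * y) with hl
  have h1l : 1 - l = r * y / (x + r * y) := by rw [hl]; field_simp; ring
  have hl0 : 0 < l := by positivity
  have hl1 : 0 < 1 - l := by rw [h1l]; positivity
  have e1 : volume (l⁻¹ • K) = ENNReal.ofReal ((x + r * y) ^ n) := by
    rw [Measure.addHaar_smul, hKx, ← ENNReal.ofReal_mul (by positivity)]
    simp only [finrank_euclideanSpace, Fintype.card_fin]
    rw [abs_of_pos (by positivity), ← mul_pow, hl]
    congr 2; field_simp
  have e2 : volume (Metric.ball (0 : Rn n) (r / (1 - l))) =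
      ENNReal.ofReal ((x + r * y) ^ n) := by
    rw [volume_ball_eq (by positivity) hyn, h1l]
    congr 2; field_simp
  have key := volume_rpow_mul_volume_rpow_le (A := l⁻¹ • K)
    (B := Metric.ball (0 : Rn n) (r / (1 - l))) (C := Metric.thickening r K) hl0 (by linarith)
    (hK.const_smul₀ _) measurableSet_ball Metric.isOpen_thickening.measurableSet ?_
  · rw [e1, e2, ← ENNReal.rpow_add _ _ (by simpa using pow_pos hs n) (by simp)] at key
    simpa using key
  · rintro _ ⟨u, hu, rfl⟩ v hv
    refine Metric.mem_thickening_iff.2 ⟨u, hu, ?_⟩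
    simp only [smul_inv_smul₀ hl0.ne']
    rw [dist_eq_norm, add_sub_cancel_left, norm_smul, Real.norm_eq_abs, abs_of_pos hl1]
    rw [mem_ball_zero_iff, lt_div_iff₀ hl1] at hv
    linarith

/-- Isoperimetry to first order in `r`, by Bernoulli: `n * y * x ^ (n - 1)` is the perimeter of a
ball of volume `x ^ n`. -/
lemma volume_add_le_volume_thickening {n : ℕ} {K : Set (Rn n)} (hK : MeasurableSet K)
    {x y r : ℝ} (hx : 0 < x) (hy : 0 < y) (hr : 0 < r) (hKx : volume K = ENNReal.ofReal (x ^ n))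
    (hyn : unitBallVolume n = y ^ n) :
    volume K + ENNReal.ofReal (r * (n * y * x ^ (n - 1))) ≤ volume (Metric.thickening r K) := by
  refine le_trans ?_ (ofReal_add_pow_le_volume_thickening hK hx hy hr hKx hyn)
  rw [hKx, ← ENNReal.ofReal_add (by positivity) (by positivity)]
  refine ENNReal.ofReal_le_ofReal ?_
  rcases n with _ | m
  · simp
  have h := one_add_mul_le_pow (a := r * y / x) (by have : 0 < r * y / x := by positivity
                                                    linarith) (m + 1)
  have e : (x + r * y) ^ (m + 1) = x ^ (m + 1) * (1 + r * y / x) ^ (m + 1) := by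
    rw [← mul_pow]; congr 1; field_simp
  rw [e]
  refine le_trans (le_of_eq ?_) (mul_le_mul_of_nonneg_left h (by positivity))
  simp only [Nat.add_sub_cancel]
  push_cast
  field_simp
  ring

/-! ### Capacity of rings -/

section Rings

variable {n : ℕ} {f : Rn n → ℝ}

lemma norm_gradient_eq (f : Rn n → ℝ) (x : Rn n) : ‖gradient f x‖ = ‖fderiv ℝ f x‖ := by
  simp [gradient]

lemma continuous_gradient (hf : ContDiff ℝ 1 f) : Continuous (gradient f) :=
  (InnerProductSpace.toDual ℝ (Rn n)).symm.continuous.comp (hf.continuous_fderiv one_ne_zero)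

/-! ### The `1`-energy of a ring. -/

lemma exists_forall_abs_sub_le (hf : ContDiff ℝ 1 f) (hc : HasCompactSupport f) {ε : ℝ}
    (hε : 0 < ε) :
    ∃ δ > 0, ∀ x y, dist y x < δ → |f y - f x| ≤ (‖gradient f x‖ + ε) * dist y x := by
  have huc : UniformContinuous (fderiv ℝ f) :=
    (hc.fderiv ℝ).uniformContinuous_of_continuous (hf.continuous_fderiv one_ne_zero)
  obtain ⟨δ, hδ, h⟩ := Metric.uniformContinuous_iff.1 huc ε hε
  refine ⟨δ, hδ, fun x y hxy => ?_⟩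
  rw [norm_gradient_eq, dist_eq_norm]
  refine Convex.norm_image_sub_le_of_norm_fderiv_le (𝕜 := ℝ) (s := Metric.ball x δ)
    (fun z _ => (hf.differentiable one_ne_zero) z) (fun z hz => ?_) (convex_ball x δ)
    (Metric.mem_ball_self hδ) hxy
  have := (h (Metric.mem_ball.1 hz)).le
  rw [dist_eq_norm] at this
  have h2 := norm_le_norm_add_norm_sub' (fderiv ℝ f z) (fderiv ℝ f x)
  linarith

lemma volume_lt_abs_lt_top (hc : HasCompactSupport f) {a : ℝ} (ha : 0 ≤ a) :
    volume {z | a < |f z|} < ⊤ := by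
  refine (measure_mono fun z hz => ?_).trans_lt hc.isCompact.measure_lt_top
  refine subset_tsupport f (Function.mem_support.2 fun h => ?_)
  rw [Set.mem_ofPred_eq, h, abs_zero] at hz
  linarith

lemma volume_le_abs_lt_top (hc : HasCompactSupport f) {a : ℝ} (ha : 0 < a) :
    volume {z | a ≤ |f z|} < ⊤ :=
  (measure_mono fun _ hz => lt_of_lt_of_le (half_lt_self ha) hz).trans_lt
    (volume_lt_abs_lt_top hc (half_pos ha).le)

/-- A coarea argument at a fixed scale `r`: measure the set `W` of pairs (point, level) in two ways.
At a level `t` the slice contains the outer `r`-collar of `{|f| ≥ t}`, so isoperimetry bounds it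
below; over a point `z` the slice lies in an interval of length `r (|∇f(z)| + ε)`. Then `r` cancels.
The margin `a' - a` keeps the collars inside `{|f| > a}`. -/
lemma ofReal_mul_le_lintegral_add (hn : n ≠ 0) (hf : ContDiff ℝ 1 f) (hc : HasCompactSupport f)
    {a a' b x y ε : ℝ} (ha : 0 ≤ a) (haa' : a < a') (hx : 0 < x) (hy : 0 < y)
    (hε : 0 < ε) (hyn : unitBallVolume n = y ^ n)
    (hxn : volume {z | b ≤ |f z|} = ENNReal.ofReal (x ^ n)) :
    ENNReal.ofReal ((b - a') * (n * y * x ^ (n - 1))) ≤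
      (∫⁻ z in {z | a < |f z| ∧ |f z| < b}, ‖gradient f z‖ₑ) +
        ENNReal.ofReal ε * volume {z | a < |f z|} := by
  obtain ⟨δ₁, hδ₁, h1⟩ := exists_forall_abs_sub_le hf hc hε
  obtain ⟨δ₂, hδ₂, h2⟩ := Metric.uniformContinuous_iff.1
    (hc.uniformContinuous_of_continuous hf.continuous) (a' - a) (sub_pos.2 haa')
  set r := min δ₁ δ₂ with hr
  have hr0 : 0 < r := lt_min hδ₁ hδ₂
  set S := {z | a < |f z| ∧ |f z| < b} with hS
  have cf : Continuous fun z => |f z| := hf.continuous.abs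
  have cg : Continuous fun z => ‖gradient f z‖ := (continuous_gradient hf).norm
  have mS : MeasurableSet S :=
    ((isOpen_lt continuous_const cf).inter (isOpen_lt cf continuous_const)).measurableSet
  set W : Set (Rn n × ℝ) := {p | (a < |f p.1| ∧ |f p.1| < p.2) ∧
    (p.2 ≤ |f p.1| + r * (‖gradient f p.1‖ + ε) ∧ (a' < p.2 ∧ p.2 < b))} with hW
  have mW : MeasurableSet W := by
    simp only [hW, Set.ofPred_and]
    refine ((measurableSet_lt ?_ ?_).inter (measurableSet_lt ?_ ?_)).inter
      ((measurableSet_le ?_ ?_).inter ((measurableSet_lt ?_ ?_).inter (measurableSet_lt ?_ ?_))) <;>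
    · apply Continuous.measurable
      have := cg.comp (continuous_fst (X := Rn n) (Y := ℝ))
      simp only [Function.comp_def] at this
      fun_prop
  have lower : ENNReal.ofReal (r * (n * y * x ^ (n - 1))) * ENNReal.ofReal (b - a') ≤
      (volume.prod volume) W := by
    rw [Measure.prod_apply_symm mW]
    have : ∫⁻ t in Set.Ioo a' b, ENNReal.ofReal (r * (n * y * x ^ (n - 1))) =
        ENNReal.ofReal (r * (n * y * x ^ (n - 1))) * ENNReal.ofReal (b - a') := by
      simp
    rw [← this]
    refine (setLIntegral_mono' measurableSet_Ioo fun t ht => ?_).trans (setLIntegral_le_lintegral _ _)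
    have hKt : volume {z | t ≤ |f z|} ≠ ⊤ :=
      (volume_le_abs_lt_top hc (ha.trans_lt (haa'.trans ht.1))).ne
    have hle : ENNReal.ofReal (x ^ n) ≤ volume {z | t ≤ |f z|} := by
      rw [← hxn]
      exact measure_mono fun z hz => ht.2.le.trans hz
    set v := (volume {z | t ≤ |f z|}).toReal with hv
    have hxv : x ^ n ≤ v := (ENNReal.ofReal_le_iff_le_toReal hKt).1 hle
    have hv0 : 0 < v := (pow_pos hx n).trans_le hxv
    have hvn : (v ^ (1 / (n : ℝ))) ^ n = v := by
      rw [one_div]; exact Real.rpow_inv_natCast_pow hv0.le hn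
    have hxle : x ≤ v ^ (1 / (n : ℝ)) := by
      refine le_of_pow_le_pow_left₀ hn (by positivity) ?_
      rw [hvn]; exact hxv
    have key := volume_add_le_volume_thickening (K := {z | t ≤ |f z|}) (x := v ^ (1 / (n : ℝ)))
      (measurableSet_le measurable_const cf.measurable) (by positivity) hy hr0
      (by rw [hvn, hv, ENNReal.ofReal_toReal hKt]) hyn
    have hsub : Metric.thickening r {z | t ≤ |f z|} ⊆
        {z | t ≤ |f z|} ∪ (fun z => (z, t)) ⁻¹' W := by
      intro z hz
      rcases le_or_gt t |f z| with h | h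
      · exact Or.inl h
      right
      obtain ⟨w, hw, hzw⟩ := Metric.mem_thickening_iff.1 hz
      rw [dist_comm] at hzw
      have k1 := h1 z w (hzw.trans_le (min_le_left _ _))
      have k2 := h2 (hzw.trans_le (min_le_right _ _))
      rw [Real.dist_eq] at k2
      have k3 := abs_sub_abs_le_abs_sub (f w) (f z)
      have k4 : (‖gradient f z‖ + ε) * dist w z ≤ r * (‖gradient f z‖ + ε) := by
        rw [mul_comm]
        gcongr
      rw [Set.mem_ofPred_eq] at hw
      refine ⟨⟨?_, h⟩, ?_, ht.1, ht.2⟩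
      · have := ht.1
        change a < |f z|
        linarith
      · change t ≤ |f z| + r * (‖gradient f z‖ + ε)
        linarith
    have k5 := key.trans ((measure_mono hsub).trans (measure_union_le _ _))
    have k6 := ENNReal.le_of_add_le_add_left hKt k5
    refine le_trans (ENNReal.ofReal_le_ofReal ?_) k6
    gcongr
  have upper : (volume.prod volume) W ≤ ENNReal.ofReal r *
      ((∫⁻ z in S, ‖gradient f z‖ₑ) + ENNReal.ofReal ε * volume {z | a < |f z|}) := by
    rw [Measure.prod_apply mW]
    calc ∫⁻ z, volume (Prod.mk z ⁻¹' W)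
        ≤ ∫⁻ z, S.indicator (fun z => ENNReal.ofReal (r * (‖gradient f z‖ + ε))) z := by
          refine lintegral_mono fun z => ?_
          by_cases hz : z ∈ S
          · rw [Set.indicator_of_mem hz]
            have : Prod.mk z ⁻¹' W ⊆ Set.Ioc |f z| (|f z| + r * (‖gradient f z‖ + ε)) :=
              fun t ht => ⟨ht.1.2, ht.2.1⟩
            refine (measure_mono this).trans ?_
            rw [Real.volume_Ioc, add_sub_cancel_left]
          · have : Prod.mk z ⁻¹' W = ∅ := by
              ext t
              simp only [Set.mem_preimage, Set.mem_empty_iff_false, iff_false]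
              exact fun ht => hz ⟨ht.1.1, ht.1.2.trans ht.2.2.2⟩
            simp [this]
      _ = ∫⁻ z in S, ENNReal.ofReal r * (‖gradient f z‖ₑ + ENNReal.ofReal ε) := by
          rw [lintegral_indicator mS]
          refine lintegral_congr fun z => ?_
          rw [ENNReal.ofReal_mul hr0.le, ENNReal.ofReal_add (norm_nonneg _) hε.le,
            ofReal_norm]
      _ = ENNReal.ofReal r * ((∫⁻ z in S, ‖gradient f z‖ₑ) + ENNReal.ofReal ε * volume S) := by
          rw [lintegral_const_mul' _ _ (by simp), lintegral_add_right _ measurable_const]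
          simp
      _ ≤ _ := by
          gcongr
          exact fun z hz => hz.1
  have := lower.trans upper
  rcases le_or_gt b a' with hb | hb
  · rw [ENNReal.ofReal_of_nonpos]
    · exact zero_le
    · exact mul_nonpos_of_nonpos_of_nonneg (by linarith) (by positivity)
  rw [ENNReal.ofReal_mul hr0.le, mul_assoc] at this
  rw [ENNReal.mul_le_mul_iff_right (by simpa using hr0) (by simp),
    ← ENNReal.ofReal_mul (by positivity), mul_comm] at this
  exact this

/-- The isoperimetric inequality in the form of a sharp lower bound for the `1`-capacity of a
ring `{a < |f| < b}`. -/
theorem ofReal_mul_le_lintegral_gradient (hn : n ≠ 0) (hf : ContDiff ℝ 1 f)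
    (hc : HasCompactSupport f) {a b x y : ℝ} (ha : 0 ≤ a) (hx : 0 < x) (hy : 0 < y)
    (hyn : unitBallVolume n = y ^ n) (hxn : volume {z | b ≤ |f z|} = ENNReal.ofReal (x ^ n)) :
    ENNReal.ofReal ((b - a) * (n * y * x ^ (n - 1))) ≤
      ∫⁻ z in {z | a < |f z| ∧ |f z| < b}, ‖gradient f z‖ₑ := by
  set A := ∫⁻ z in {z | a < |f z| ∧ |f z| < b}, ‖gradient f z‖ₑ
  have t1 : Filter.Tendsto (fun θ : ℝ => ENNReal.ofReal ((b - (a + θ)) * (n * y * x ^ (n - 1))))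
      (nhdsWithin 0 (Set.Ioi 0)) (nhds (ENNReal.ofReal ((b - a) * (n * y * x ^ (n - 1))))) := by
    refine Filter.Tendsto.mono_left ?_ nhdsWithin_le_nhds
    have : Continuous fun θ : ℝ => ENNReal.ofReal ((b - (a + θ)) * (n * y * x ^ (n - 1))) :=
      ENNReal.continuous_ofReal.comp (by fun_prop)
    simpa using this.tendsto 0
  have t2 : Filter.Tendsto (fun θ : ℝ => A + ENNReal.ofReal θ * volume {z | a < |f z|})
      (nhdsWithin 0 (Set.Ioi 0)) (nhds (A + 0)) := by
    refine Filter.Tendsto.mono_left ?_ nhdsWithin_le_nhds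
    refine tendsto_const_nhds.add ?_
    have := ENNReal.Tendsto.mul_const (b := volume {z | a < |f z|})
      (ENNReal.continuous_ofReal.tendsto 0) (.inr (volume_lt_abs_lt_top hc ha).ne)
    simpa using this
  rw [add_zero] at t2
  refine le_of_tendsto_of_tendsto t1 t2 ?_
  filter_upwards [self_mem_nhdsWithin] with θ hθ
  exact ofReal_mul_le_lintegral_add hn hf hc ha (by simpa using hθ) hx hy hθ hyn hxn

/-- The volume of `{a < |f|}`. -/
def openLevelVolume (f : Rn n → ℝ) (a : ℝ) : ℝ := volume.real {z | a < |f z|}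

/-- The volume of `{b ≤ |f|}`. -/
def closedLevelVolume (f : Rn n → ℝ) (b : ℝ) : ℝ := volume.real {z | b ≤ |f z|}

/-- The `n`-energy of `f` on the ring `{a < |f| < b}`. -/
def ringEnergy (f : Rn n → ℝ) (a b : ℝ) : ℝ :=
  (∫⁻ z in {z | a < |f z| ∧ |f z| < b}, ‖gradient f z‖ₑ ^ (n : ℝ)).toReal

lemma hasCompactSupport_gradient (hc : HasCompactSupport f) : HasCompactSupport (gradient f) :=
  (hc.fderiv ℝ).comp_left (map_zero (InnerProductSpace.toDual ℝ (Rn n)).symm)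

lemma lintegral_gradient_lt_top (hn : n ≠ 0) (hf : ContDiff ℝ 1 f) (hc : HasCompactSupport f)
    (s : Set (Rn n)) : ∫⁻ z in s, ‖gradient f z‖ₑ ^ (n : ℝ) < ⊤ := by
  have h := (continuous_gradient hf).memLp_of_hasCompactSupport (μ := volume) (p := n)
    (hasCompactSupport_gradient hc)
  have := lintegral_rpow_enorm_lt_top_of_eLpNorm_lt_top (by simpa using hn) (by simp) h.2
  exact (setLIntegral_le_lintegral _ _).trans_lt (by simpa using this)

lemma ringEnergy_nonneg (f : Rn n → ℝ) (a b : ℝ) : 0 ≤ ringEnergy f a b := ENNReal.toReal_nonneg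

lemma measurableSet_ring (hf : Continuous f) (a b : ℝ) :
    MeasurableSet {z | a < |f z| ∧ |f z| < b} :=
  ((isOpen_lt continuous_const hf.abs).inter (isOpen_lt hf.abs continuous_const)).measurableSet

lemma ringEnergy_add_le (hn : n ≠ 0) (hf : ContDiff ℝ 1 f) (hc : HasCompactSupport f)
    {a t b : ℝ} (hat : a ≤ t) (htb : t ≤ b) :
    ringEnergy f a t + ringEnergy f t b ≤ ringEnergy f a b := by
  rw [ringEnergy, ringEnergy, ringEnergy, ← ENNReal.toReal_add
    (lintegral_gradient_lt_top hn hf hc _).ne (lintegral_gradient_lt_top hn hf hc _).ne,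
    ← lintegral_union (measurableSet_ring hf.continuous _ _)]
  · refine ENNReal.toReal_mono (lintegral_gradient_lt_top hn hf hc _).ne
      (lintegral_mono_set ?_)
    rintro z (hz | hz)
    · exact ⟨hz.1, hz.2.trans_le htb⟩
    · exact ⟨hat.trans_lt hz.1, hz.2⟩
  · exact Set.disjoint_left.2 fun z hz hz' => lt_asymm hz.2 hz'.1

lemma ringEnergy_mono (hn : n ≠ 0) (hf : ContDiff ℝ 1 f) (hc : HasCompactSupport f)
    {a a' b : ℝ} (h : a ≤ a') : ringEnergy f a' b ≤ ringEnergy f a b :=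
  ENNReal.toReal_mono (lintegral_gradient_lt_top hn hf hc _).ne
    (lintegral_mono_set fun _ hz => ⟨h.trans_lt hz.1, hz.2⟩)

lemma openLevelVolume_le_closedLevelVolume (hc : HasCompactSupport f) {a : ℝ} (ha : 0 < a) :
    openLevelVolume f a ≤ closedLevelVolume f a :=
  measureReal_mono (fun z (hz : a < |f z|) => hz.le) (volume_le_abs_lt_top hc ha).ne

lemma openLevelVolume_anti (hc : HasCompactSupport f) {a b : ℝ} (ha : 0 ≤ a) (hab : a ≤ b) :
    openLevelVolume f b ≤ openLevelVolume f a :=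
  measureReal_mono (fun _ hz => lt_of_le_of_lt hab hz) (volume_lt_abs_lt_top hc ha).ne

/-! ### The `n`-energy of a ring: Hölder's inequality and intermediate levels. -/

lemma lintegral_pow_le (hn : 2 ≤ n) {g : Rn n → ℝ≥0∞} (hg : Measurable g) (S : Set (Rn n)) :
    (∫⁻ z in S, g z) ^ n ≤ (∫⁻ z in S, g z ^ (n : ℝ)) * volume S ^ (n - 1) := by
  have hn1 : (1 : ℝ) < n := by exact_mod_cast hn
  have hn0 : (n : ℝ) ≠ 0 := by positivity
  have hpq : (n : ℝ).HolderConjugate ((n : ℝ) / (n - 1)) := .conjExponent hn1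
  have h := ENNReal.lintegral_mul_le_Lp_mul_Lq (volume.restrict S) hpq hg.aemeasurable
    (g := 1) aemeasurable_const
  simp only [Pi.mul_apply, Pi.one_apply, mul_one, ENNReal.one_rpow, lintegral_const,
    Measure.restrict_apply MeasurableSet.univ, Set.univ_inter, one_mul] at h
  have h2 := ENNReal.rpow_le_rpow h (by positivity : (0 : ℝ) ≤ n)
  rw [ENNReal.mul_rpow_of_nonneg _ _ (by positivity), ← ENNReal.rpow_mul, ← ENNReal.rpow_mul,
    ENNReal.rpow_natCast] at h2
  have e1 : 1 / (n : ℝ) * n = 1 := by field_simp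
  have e2 : 1 / ((n : ℝ) / (n - 1)) * n = (n - 1 : ℕ) := by
    rw [Nat.cast_sub (by omega)]
    push_cast
    field_simp
  rwa [e1, e2, ENNReal.rpow_one, ENNReal.rpow_natCast] at h2

/-- Hölder applied to the `1`-energy bound. This is sharp only for thin rings, which is why rings
are subdivided below. -/
lemma mul_pow_le_ringEnergy_mul_pow (hn : 2 ≤ n) (hf : ContDiff ℝ 1 f) (hc : HasCompactSupport f)
    {a b : ℝ} (ha : 0 ≤ a) (hab : a < b) (hb : 0 < closedLevelVolume f b) :
    (n : ℝ) ^ n * unitBallVolume n * (b - a) ^ n * closedLevelVolume f b ^ (n - 1) ≤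
      ringEnergy f a b * (openLevelVolume f a - closedLevelVolume f b) ^ (n - 1) := by
  have hn0 : n ≠ 0 := by omega
  obtain ⟨y, hy, hyn⟩ : ∃ y : ℝ, 0 < y ∧ unitBallVolume n = y ^ n :=
    ⟨unitBallVolume n ^ ((n : ℝ)⁻¹), Real.rpow_pos_of_pos (unitBallVolume_pos n) _,
      (Real.rpow_inv_natCast_pow (unitBallVolume_pos n).le hn0).symm⟩
  obtain ⟨x, hx, hxn⟩ : ∃ x : ℝ, 0 < x ∧ closedLevelVolume f b = x ^ n :=
    ⟨closedLevelVolume f b ^ ((n : ℝ)⁻¹), Real.rpow_pos_of_pos hb _,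
      (Real.rpow_inv_natCast_pow hb.le hn0).symm⟩
  have hbT := (volume_le_abs_lt_top hc (ha.trans_lt hab)).ne
  have haT := (volume_lt_abs_lt_top hc ha).ne
  have h1 := ofReal_mul_le_lintegral_gradient hn0 hf hc ha hx hy hyn (b := b)
    (by rw [← hxn, closedLevelVolume, ofReal_measureReal hbT])
  have h2 := (pow_le_pow_left' h1 n).trans
    (lintegral_pow_le hn (continuous_gradient hf).enorm.measurable _)
  have hS : volume {z | a < |f z| ∧ |f z| < b} =
      ENNReal.ofReal (openLevelVolume f a - closedLevelVolume f b) := by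
    have : {z | a < |f z| ∧ |f z| < b} = {z | a < |f z|} \ {z | b ≤ |f z|} := by
      ext z; simp
    rw [openLevelVolume, closedLevelVolume, this,
      ← measureReal_sdiff (s₁ := {z | a < |f z|}) (s₂ := {z | b ≤ |f z|})
        (fun z hz => lt_of_lt_of_le hab hz) ?_ haT,
      ofReal_measureReal (measure_ne_top_of_subset Set.sdiff_subset haT)]
    exact measurableSet_le measurable_const hf.continuous.abs.measurable
  have hMm : 0 ≤ openLevelVolume f a - closedLevelVolume f b :=
    sub_nonneg.2 (measureReal_mono (fun z hz => lt_of_lt_of_le hab hz) haT)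
  have hD : ∫⁻ z in {z | a < |f z| ∧ |f z| < b}, ‖gradient f z‖ₑ ^ (n : ℝ) =
      ENNReal.ofReal (ringEnergy f a b) :=
    (ENNReal.ofReal_toReal (lintegral_gradient_lt_top hn0 hf hc _).ne).symm
  have hba : 0 < b - a := sub_pos.2 hab
  rw [hS, hD, ← ENNReal.ofReal_pow (by positivity), ← ENNReal.ofReal_pow hMm,
    ← ENNReal.ofReal_mul (ringEnergy_nonneg _ _ _), ENNReal.ofReal_le_ofReal_iff
      (mul_nonneg (ringEnergy_nonneg _ _ _) (pow_nonneg hMm _))] at h2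
  refine le_trans (le_of_eq ?_) h2
  rw [hyn, hxn]
  generalize b - a = d
  ring

/-- By inner regularity it suffices to treat a compact `K ⊆ G`; `|f|` attains its minimum on `K`,
and the superlevel set of a minimiser contains `K`. -/
lemma volume_le_of_forall_volume_superlevel_le (hf : Continuous f) {G : Set (Rn n)}
    (hG : MeasurableSet G) {η : ℝ≥0∞} (h : ∀ z ∈ G, volume {w | |f z| ≤ |f w|} ≤ η) :
    volume G ≤ η := by
  rw [hG.measure_eq_iSup_isCompact]
  refine iSup₂_le fun K hKG => iSup_le fun hK => ?_
  rcases K.eq_empty_or_nonempty with rfl | hne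
  · simp
  obtain ⟨z, hz, hmin⟩ := hK.exists_isMinOn hne hf.abs.continuousOn
  exact (measure_mono fun w hw => hmin hw).trans (h z (hKG hz))

/-- The level is the last one in `[a, b]` whose closed superlevel set still has volume at least `θ`.
Level sets may have positive measure, so no level need have volume exactly `θ`; open and closed
superlevel sets bracket it instead. -/
lemma exists_level_between (hf : Continuous f) (hc : HasCompactSupport f) {a b θ : ℝ}
    (ha : 0 < a) (hab : a ≤ b) (hθ : θ ≤ closedLevelVolume f a) :
    ∃ t, a ≤ t ∧ t ≤ b ∧ θ ≤ closedLevelVolume f t ∧ (t < b → openLevelVolume f t ≤ θ) := by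
  set T := {s | (a ≤ s ∧ s ≤ b) ∧ θ ≤ closedLevelVolume f s} with hT
  have haT : a ∈ T := ⟨⟨le_rfl, hab⟩, hθ⟩
  have hbdd : BddAbove T := ⟨b, fun s hs => hs.1.2⟩
  have hat : a ≤ sSup T := le_csSup hbdd haT
  refine ⟨sSup T, hat, csSup_le ⟨a, haT⟩ fun s hs => hs.1.2, ?_, ?_⟩
  · obtain ⟨u, hu, hut, huT⟩ := exists_seq_tendsto_sSup ⟨a, haT⟩ hbdd
    have e : {z | sSup T ≤ |f z|} = ⋂ j, {z | u j ≤ |f z|} := by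
      ext z
      simp only [Set.mem_ofPred_eq, Set.mem_iInter]
      exact ⟨fun h j => (le_csSup hbdd (huT j)).trans h, fun h => le_of_tendsto' hut h⟩
    have ht := tendsto_measure_iInter_atTop (μ := volume) (s := fun j => {z | u j ≤ |f z|})
      (fun j => (measurableSet_le measurable_const hf.abs.measurable).nullMeasurableSet)
      (fun i j hij z hz => (hu hij).trans hz)
      ⟨0, (volume_le_abs_lt_top hc (ha.trans_le (huT 0).1.1)).ne⟩
    rw [← e] at ht
    have ht' := (ENNReal.tendsto_toReal (volume_le_abs_lt_top hc (ha.trans_le hat)).ne).comp ht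
    exact ge_of_tendsto' ht' fun j => (huT j).2
  · intro htb
    have key : volume {z | sSup T < |f z|} ≤ ENNReal.ofReal θ := by
      refine volume_le_of_forall_volume_superlevel_le hf
        (measurableSet_lt measurable_const hf.abs.measurable) fun z hz => ?_
      set s := min |f z| b with hs
      have hts : sSup T < s := lt_min hz htb
      have hsT : s ∉ T := fun h => (le_csSup hbdd h).not_gt hts
      have h1 : closedLevelVolume f s < θ := by
        by_contra! h
        exact hsT ⟨⟨hat.trans hts.le, min_le_right _ _⟩, h⟩
      refine (measure_mono (t := {w | s ≤ |f w|})
        fun w hw => (min_le_left |f z| b).trans hw).trans ?_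
      rw [← ofReal_measureReal (volume_le_abs_lt_top hc (ha.trans_le (hat.trans hts.le))).ne]
      exact ENNReal.ofReal_le_ofReal h1.le
    have hθ0 : 0 ≤ θ := by
      by_contra! h
      have hbT : b ∈ T := ⟨⟨hab, le_rfl⟩, h.le.trans measureReal_nonneg⟩
      exact (le_csSup hbdd hbT).not_gt htb
    exact ENNReal.toReal_le_of_le_ofReal hθ0 key

/-- Each halving of the ring replaces the volume ratio `X` by `√X`. Energies of the pieces add, and
`(p + q)^n ≤ 2^(n-1) (p^n + q^n)` supplies the next factor `2` inside the power. -/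
lemma mul_pow_le_ringEnergy_mul_dyadic (hn : 2 ≤ n) (hf : ContDiff ℝ 1 f)
    (hc : HasCompactSupport f) (k : ℕ) {a b X : ℝ} (ha : 0 < a) (hab : a ≤ b)
    (hb : 0 < closedLevelVolume f b) (hX : 1 ≤ X)
    (h : openLevelVolume f a ≤ X * closedLevelVolume f b) :
    (n : ℝ) ^ n * unitBallVolume n * (b - a) ^ n ≤
      ringEnergy f a b * (2 ^ k * (X ^ ((1 : ℝ) / 2 ^ k) - 1)) ^ (n - 1) := by
  have hn0 : n ≠ 0 := by omega
  induction k generalizing a b X with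
  | zero =>
    simp only [pow_zero, div_one, Real.rpow_one, one_mul]
    rcases hab.eq_or_lt with rfl | hab
    · simp only [sub_self, zero_pow hn0, mul_zero]
      exact mul_nonneg (ringEnergy_nonneg _ _ _) (pow_nonneg (by linarith) _)
    have h1 := mul_pow_le_ringEnergy_mul_pow hn hf hc ha.le hab hb
    have h0 : closedLevelVolume f b ≤ openLevelVolume f a :=
      measureReal_mono (fun z hz => lt_of_lt_of_le hab hz) (volume_lt_abs_lt_top hc ha.le).ne
    have h2 : (openLevelVolume f a - closedLevelVolume f b) ^ (n - 1) ≤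
        ((X - 1) * closedLevelVolume f b) ^ (n - 1) :=
      pow_le_pow_left₀ (by linarith) (by linarith) _
    have h3 := h1.trans (mul_le_mul_of_nonneg_left h2 (ringEnergy_nonneg f a b))
    rw [mul_pow, ← mul_assoc] at h3
    exact le_of_mul_le_mul_right h3 (pow_pos hb _)
  | succ k ih =>
    have hX0 : 0 ≤ X := by linarith
    have hs1 : 1 ≤ √X := by rwa [Real.one_le_sqrt]
    have hs0 : 0 < √X := by linarith
    have hsq : √X * √X = X := Real.mul_self_sqrt hX0
    -- The volume at the cut is a geometric mean: both pieces get ratio at most `√X`.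
    obtain ⟨t, hat, htb, ht1, ht2⟩ := exists_level_between hf.continuous hc
      (θ := openLevelVolume f a / √X) ha hab
      ((div_le_self measureReal_nonneg hs1).trans (openLevelVolume_le_closedLevelVolume hc ha))
    have hbT := (volume_le_abs_lt_top hc (ha.trans_le hat)).ne
    have i1 := ih ha hat (hb.trans_le (measureReal_mono (fun z hz => htb.trans hz) hbT)) hs1
      (by rw [mul_comm]; exact (div_le_iff₀ hs0).1 ht1)
    have i2 := ih (ha.trans_le hat) htb hb hs1 (by
      rcases htb.eq_or_lt with e | hlt
      · rw [e]
        refine (openLevelVolume_le_closedLevelVolume hc (ha.trans_le hab)).trans ?_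
        nlinarith
      · refine (ht2 hlt).trans ?_
        rw [div_le_iff₀ hs0]
        calc _ ≤ √X * √X * closedLevelVolume f b := by rwa [hsq]
          _ = _ := by ring)
    have eX : X ^ ((1 : ℝ) / 2 ^ (k + 1)) = √X ^ ((1 : ℝ) / 2 ^ k) := by
      rw [Real.sqrt_eq_rpow, ← Real.rpow_mul hX0]
      congr 1
      rw [pow_succ]; field_simp
    rw [eX]
    set z := 2 ^ k * (√X ^ ((1 : ℝ) / 2 ^ k) - 1)
    have hz : 0 ≤ z := mul_nonneg (by positivity)
      (sub_nonneg.2 (Real.one_le_rpow hs1 (by positivity)))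
    have ez : 2 ^ (k + 1) * (√X ^ ((1 : ℝ) / 2 ^ k) - 1) = 2 * z := by simp only [z]; ring
    rw [ez]
    clear_value z
    have hc0 : 0 ≤ (n : ℝ) ^ n * unitBallVolume n :=
      mul_nonneg (by positivity) (unitBallVolume_pos n).le
    have hadd := add_pow_le (sub_nonneg.2 hat) (sub_nonneg.2 htb) n
    have hE := ringEnergy_add_le hn0 hf hc hat htb
    calc (n : ℝ) ^ n * unitBallVolume n * (b - a) ^ n
        = (n : ℝ) ^ n * unitBallVolume n * (t - a + (b - t)) ^ n := by ring
      _ ≤ (n : ℝ) ^ n * unitBallVolume n * (2 ^ (n - 1) * ((t - a) ^ n + (b - t) ^ n)) := by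
          gcongr
      _ = 2 ^ (n - 1) * ((n : ℝ) ^ n * unitBallVolume n * (t - a) ^ n +
            (n : ℝ) ^ n * unitBallVolume n * (b - t) ^ n) := by ring
      _ ≤ 2 ^ (n - 1) * (ringEnergy f a t * z ^ (n - 1) + ringEnergy f t b * z ^ (n - 1)) := by
          gcongr
      _ = (ringEnergy f a t + ringEnergy f t b) * (2 * z) ^ (n - 1) := by rw [mul_pow]; ring
      _ ≤ _ := by gcongr

lemma tendsto_dyadic_log {X : ℝ} (hX : 0 < X) :
    Filter.Tendsto (fun k : ℕ => 2 ^ k * (X ^ ((1 : ℝ) / 2 ^ k) - 1)) Filter.atTop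
      (nhds (Real.log X)) := by
  have h := ((Real.hasStrictDerivAt_const_rpow hX 0).hasDerivAt).tendsto_slope_zero
  simp only [zero_add, Real.rpow_zero, one_mul, smul_eq_mul] at h
  have h2 : Filter.Tendsto (fun k : ℕ => ((1 : ℝ) / 2) ^ k) Filter.atTop (nhdsWithin 0 {0}ᶜ) :=
    tendsto_nhdsWithin_iff.2 ⟨tendsto_pow_atTop_nhds_zero_of_lt_one (by norm_num) (by norm_num),
      .of_forall fun k => by simp⟩
  refine (h.comp h2).congr fun k => ?_
  simp

/-- The sharp lower bound for the `n`-capacity of the ring `{a < |f| < b}` by volumes. -/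
theorem mul_pow_le_ringEnergy_mul_log_pow (hn : 2 ≤ n) (hf : ContDiff ℝ 1 f)
    (hc : HasCompactSupport f) {a b X : ℝ} (ha : 0 ≤ a) (hab : a ≤ b)
    (hb : 0 < closedLevelVolume f b) (hX : 1 ≤ X)
    (h : openLevelVolume f a ≤ X * closedLevelVolume f b) :
    (n : ℝ) ^ n * unitBallVolume n * (b - a) ^ n ≤
      ringEnergy f a b * Real.log X ^ (n - 1) := by
  have hn0 : n ≠ 0 := by omega
  have pos : ∀ {a : ℝ}, 0 < a → a ≤ b → openLevelVolume f a ≤ X * closedLevelVolume f b →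
      (n : ℝ) ^ n * unitBallVolume n * (b - a) ^ n ≤
        ringEnergy f a b * Real.log X ^ (n - 1) := by
    intro a ha hab h
    refine ge_of_tendsto' (((tendsto_dyadic_log (by linarith)).pow (n - 1)).const_mul _)
      fun k => mul_pow_le_ringEnergy_mul_dyadic hn hf hc k ha hab hb hX h
  rcases hab.eq_or_lt with rfl | hab
  · simp only [sub_self, zero_pow hn0, mul_zero]
    exact mul_nonneg (ringEnergy_nonneg _ _ _) (pow_nonneg (Real.log_nonneg hX) _)
  -- The level `a = 0` is reached from above, because the dyadic bound needs closed superlevel sets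
  -- of finite volume.
  have t : Filter.Tendsto (fun s : ℝ => (n : ℝ) ^ n * unitBallVolume n * (b - s) ^ n)
      (nhdsWithin a (Set.Ioi a)) (nhds ((n : ℝ) ^ n * unitBallVolume n * (b - a) ^ n)) := by
    refine Filter.Tendsto.mono_left (Continuous.tendsto ?_ a) nhdsWithin_le_nhds
    fun_prop
  refine le_of_tendsto t ?_
  filter_upwards [Ioo_mem_nhdsGT hab] with s hs
  refine (pos (ha.trans_lt hs.1) hs.2.le ((openLevelVolume_anti hc ha hs.1.le).trans h)).trans ?_
  have := ringEnergy_mono (b := b) hn0 hf hc hs.1.le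
  have := Real.log_nonneg hX
  gcongr

end Rings

/-! ### The capacity–volume inequality -/

section TestFunctions

variable {n : ℕ} {Ω : Opens (Rn n)}

lemma volume_lt_top_of_mem_AC (hΩ : Ω ∈ AC (⊤ : Opens (Rn n))) :
    volume (Ω : Set (Rn n)) < ⊤ :=
  (measure_mono subset_closure).trans_lt hΩ.2.1.measure_lt_top

lemma support_subset (φ : 𝓓(Ω, ℝ)) {z : Rn n} (hz : φ z ≠ 0) : z ∈ (Ω : Set (Rn n)) :=
  φ.tsupport_subset (subset_tsupport _ (Function.mem_support.2 hz))

lemma openLevelVolume_zero_le (hΩ : volume (Ω : Set (Rn n)) < ⊤) (φ : 𝓓(Ω, ℝ)) :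
    openLevelVolume φ 0 ≤ volume.real (Ω : Set (Rn n)) :=
  measureReal_mono (fun _ hz => support_subset φ (abs_pos.1 hz)) hΩ.ne

lemma contDiff_one (φ : 𝓓(Ω, ℝ)) : ContDiff ℝ 1 φ := φ.contDiff.of_le (by simp)

lemma ofReal_ringEnergy_le (hn : n ≠ 0) (φ : 𝓓(Ω, ℝ)) {a : ℝ} (ha : 0 ≤ a) (b : ℝ) :
    ENNReal.ofReal (ringEnergy φ a b) ≤
      ∫⁻ z in (Ω : Set (Rn n)), ‖gradient φ z‖ₑ ^ (n : ℝ) := by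
  rw [ringEnergy, ENNReal.ofReal_toReal
    (lintegral_gradient_lt_top hn (contDiff_one φ) φ.hasCompactSupport _).ne]
  refine lintegral_mono_set fun z hz => support_subset φ (abs_pos.1 (ha.trans_lt hz.1))

/-- The capacity–volume inequality holds on every open set of finite volume. -/
theorem capacityVolumeInequality (hn : 2 ≤ n) (hΩ : volume (Ω : Set (Rn n)) < ⊤) :
    CapacityVolumeInequality Ω := by
  intro S hS
  rcases eq_or_ne (volume (S : Set (Rn n))) 0 with h0 | h0
  · simp [h0]
  have hSΩ : (S : Set (Rn n)) ⊆ Ω := subset_closure.trans hS.2.2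
  have hSle : volume (S : Set (Rn n)) ≤ volume (Ω : Set (Rn n)) := measure_mono hSΩ
  have hST : volume (S : Set (Rn n)) ≠ ⊤ := (hSle.trans_lt hΩ).ne
  set s := volume.real (S : Set (Rn n)) with hs
  set V := volume.real (Ω : Set (Rn n)) with hV
  have hs0 : 0 < s := ENNReal.toReal_pos h0 hST
  have hsV : s ≤ V := measureReal_mono hSΩ hΩ.ne
  have hV0 : 0 < V := hs0.trans_le hsV
  have hX : 1 ≤ V / s := (one_le_div hs0).2 hsV
  set L := Real.log (V / s) with hL
  have hL0 : 0 ≤ L := Real.log_nonneg hX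
  set c := (n : ℝ) ^ n * unitBallVolume n with hc
  have hc0 : 0 < c := mul_pos (by positivity) (unitBallVolume_pos n)
  have hn1 : (0 : ℝ) < n - 1 := by
    have : (2 : ℝ) ≤ n := by exact_mod_cast hn
    linarith
  -- For admissible `φ`, `{|φ| ≥ 1}` contains `S` and `{|φ| > 0}` lies in `Ω`. If `L = 0` the left
  -- side is `⊤`, and the ring estimate shows that there is no admissible `φ`.
  have key : ENNReal.ofReal c / ENNReal.ofReal (L ^ (n - 1)) ≤
      cap (n : ℝ) (closure (S : Set (Rn n))) Ω := by
    refine le_iInf₂ fun φ hφ => ENNReal.div_le_of_le_mul ?_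
    have hs1 : s ≤ closedLevelVolume φ 1 :=
      measureReal_mono (fun z hz => (hφ z (subset_closure hz)).trans (le_abs_self _))
        (volume_le_abs_lt_top φ.hasCompactSupport one_pos).ne
    have h := mul_pow_le_ringEnergy_mul_log_pow hn (contDiff_one φ) φ.hasCompactSupport le_rfl
      zero_le_one (hs0.trans_le hs1) hX (by
        refine (openLevelVolume_zero_le hΩ φ).trans ?_
        calc V = V / s * s := by field_simp
          _ ≤ _ := by gcongr)
    rw [sub_zero, one_pow, mul_one] at h
    refine (ENNReal.ofReal_le_ofReal h).trans ?_
    rw [ENNReal.ofReal_mul (ringEnergy_nonneg _ _ _)]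
    gcongr
    exact ofReal_ringEnergy_le (by omega) φ le_rfl 1
  have hle : (ENNReal.ofReal c / cap (n : ℝ) (closure (S : Set (Rn n))) Ω) ^
      (1 / ((n : ℝ) - 1)) ≤ ENNReal.ofReal L := by
    have hc1 : ENNReal.ofReal c ≠ 0 := by simpa using hc0
    have h1 := ENNReal.inv_le_inv.2 key
    rw [ENNReal.inv_div (.inl ENNReal.ofReal_ne_top) (.inr hc1)] at h1
    have h2 := mul_le_mul_right h1 (ENNReal.ofReal c)
    rw [← div_eq_mul_inv, ENNReal.mul_div_cancel hc1 ENNReal.ofReal_ne_top] at h2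
    refine (ENNReal.rpow_le_rpow h2 (by positivity)).trans (le_of_eq ?_)
    rw [ENNReal.ofReal_pow hL0, ← ENNReal.rpow_natCast, ← ENNReal.rpow_mul,
      Nat.cast_sub (by omega), Nat.cast_one, mul_one_div_cancel hn1.ne', ENNReal.rpow_one]
  have hmono := EReal.exp_monotone (EReal.neg_le_neg_iff.2 (EReal.coe_ennreal_le_coe_ennreal_iff.2 hle))
  refine le_trans (le_of_eq ?_) hmono
  rw [EReal.coe_ennreal_ofReal, max_eq_left hL0, ← EReal.coe_neg, EReal.exp_coe, hL, Real.exp_neg,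
    Real.exp_log (by positivity), inv_div, ENNReal.ofReal_div_of_pos hV0, hs, hV,
    ofReal_measureReal hST, ofReal_measureReal hΩ.ne]

/-! ### The Faber–Krahn inequality -/

/-- Dividing by the power `1 / (1 - n)` is multiplying by the power `1 / (n - 1)`. The identity
links Moser's exponent both to `|f|^n` and to the ring estimate. -/
lemma moserTrudinger_exponent_pow (hn : 2 ≤ n) (t : ℝ) :
    (|t| ^ ((n : ℝ) / ((n : ℝ) - 1)) /
      ((n : ℝ) ^ n * unitBallVolume n) ^ (1 / (1 - (n : ℝ)))) ^ (n - 1) =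
      (n : ℝ) ^ n * unitBallVolume n * |t| ^ n := by
  have hn1 : (0 : ℝ) < n - 1 := by
    have : (2 : ℝ) ≤ n := by exact_mod_cast hn
    linarith
  have hn2 : (1 : ℝ) - n ≠ 0 := by linarith
  have hc0 : 0 ≤ (n : ℝ) ^ n * unitBallVolume n := mul_nonneg (by positivity) (unitBallVolume_pos n).le
  have e : ((n - 1 : ℕ) : ℝ) = n - 1 := by rw [Nat.cast_sub (by omega), Nat.cast_one]
  rw [div_pow, ← Real.rpow_natCast, ← Real.rpow_mul (abs_nonneg _), ← Real.rpow_natCast _ (n - 1),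
    ← Real.rpow_mul hc0, e, div_mul_cancel₀ _ hn1.ne',
    show 1 / (1 - (n : ℝ)) * (n - 1) = -1 by field_simp; ring, Real.rpow_neg_one, div_inv_eq_mul,
    Real.rpow_natCast, mul_comm]

lemma moserTrudinger_exponent_nonneg (n : ℕ) (t : ℝ) :
    0 ≤ |t| ^ ((n : ℝ) / ((n : ℝ) - 1)) /
      ((n : ℝ) ^ n * unitBallVolume n) ^ (1 / (1 - (n : ℝ))) :=
  div_nonneg (Real.rpow_nonneg (abs_nonneg _) _)
    (Real.rpow_nonneg (mul_nonneg (by positivity) (unitBallVolume_pos n).le) _)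

/-- From `u^(n-1) / (n-1)! ≤ exp u` with `u` the Moser exponent; this is the source of the
factorial. -/
lemma ofReal_mul_lintegral_le_of_energy_le_one (hn : 2 ≤ n)
    (hΩ : volume (Ω : Set (Rn n)) < ⊤) (φ : 𝓓(Ω, ℝ))
    (hφ : ∫⁻ x in (Ω : Set (Rn n)), ‖gradient φ x‖ₑ ^ (n : ℝ) ≤ 1) :
    ENNReal.ofReal ((n : ℝ) ^ n * unitBallVolume n / ((n - 1).factorial : ℝ)) *
      ∫⁻ x in (Ω : Set (Rn n)), ‖φ x‖ₑ ^ (n : ℝ) ≤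
      moserTrudinger Ω * volume (Ω : Set (Rn n)) := by
  rcases eq_or_ne (volume (Ω : Set (Rn n))) 0 with h0 | h0
  · simp [Measure.restrict_zero_set h0]
  have hc0 : 0 ≤ (n : ℝ) ^ n * unitBallVolume n := mul_nonneg (by positivity) (unitBallVolume_pos n).le
  have h1 := le_iSup₂ (f := fun (f : 𝓓(Ω, ℝ))
    (_ : ∫⁻ x in (Ω : Set (Rn n)), ‖gradient f x‖ₑ ^ (n : ℝ) ≤ 1) =>
    (volume (Ω : Set (Rn n)))⁻¹ * ∫⁻ x in (Ω : Set (Rn n)), ENNReal.ofReal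
      (Real.exp (|f x| ^ ((n : ℝ) / ((n : ℝ) - 1)) /
        ((n : ℝ) ^ n * unitBallVolume n) ^ (1 / (1 - (n : ℝ)))))) φ hφ
  have h2 : ∫⁻ x in (Ω : Set (Rn n)), ENNReal.ofReal
      (Real.exp (|φ x| ^ ((n : ℝ) / ((n : ℝ) - 1)) /
        ((n : ℝ) ^ n * unitBallVolume n) ^ (1 / (1 - (n : ℝ))))) ≤
      moserTrudinger Ω * volume (Ω : Set (Rn n)) := by
    refine le_trans (le_of_eq ?_) (mul_le_mul_left h1 (volume (Ω : Set (Rn n))))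
    rw [mul_right_comm, ENNReal.inv_mul_cancel h0 hΩ.ne, one_mul]
  refine le_trans ?_ h2
  rw [← lintegral_const_mul' _ _ ENNReal.ofReal_ne_top]
  refine lintegral_mono fun x => ?_
  rw [ENNReal.rpow_natCast, Real.enorm_eq_ofReal_abs, ← ENNReal.ofReal_pow (abs_nonneg _),
    ← ENNReal.ofReal_mul (by positivity)]
  refine ENNReal.ofReal_le_ofReal ?_
  rw [div_mul_eq_mul_div, ← moserTrudinger_exponent_pow hn]
  exact Real.pow_div_factorial_le_exp _ (moserTrudinger_exponent_nonneg n _) _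

lemma energy_smul (φ : 𝓓(Ω, ℝ)) {t : ℝ} (ht : 0 ≤ t) :
    ∫⁻ x in (Ω : Set (Rn n)), ‖gradient (t • φ : 𝓓(Ω, ℝ)) x‖ₑ ^ (n : ℝ) =
      ENNReal.ofReal (t ^ n) * ∫⁻ x in (Ω : Set (Rn n)), ‖gradient φ x‖ₑ ^ (n : ℝ) := by
  rw [← lintegral_const_mul' _ _ ENNReal.ofReal_ne_top]
  refine lintegral_congr fun x => ?_
  have : gradient (t • φ : 𝓓(Ω, ℝ)) x = t • gradient φ x := by
    have e : ((t • φ : 𝓓(Ω, ℝ)) : Rn n → ℝ) = t • (φ : Rn n → ℝ) := rfl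
    rw [e, gradient, fderiv_const_smul ((contDiff_one φ).differentiable one_ne_zero x)]
    simp [gradient]
  rw [this, enorm_smul, Real.enorm_eq_ofReal ht, ENNReal.rpow_natCast, ENNReal.rpow_natCast,
    mul_pow, ENNReal.ofReal_pow ht]

lemma lintegral_smul_pow (φ : 𝓓(Ω, ℝ)) {t : ℝ} (ht : 0 ≤ t) :
    ∫⁻ x in (Ω : Set (Rn n)), ‖(t • φ : 𝓓(Ω, ℝ)) x‖ₑ ^ (n : ℝ) =
      ENNReal.ofReal (t ^ n) * ∫⁻ x in (Ω : Set (Rn n)), ‖φ x‖ₑ ^ (n : ℝ) := by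
  rw [← lintegral_const_mul' _ _ ENNReal.ofReal_ne_top]
  refine lintegral_congr fun x => ?_
  have : (t • φ : 𝓓(Ω, ℝ)) x = t • φ x := rfl
  rw [this, enorm_smul, Real.enorm_eq_ofReal ht, ENNReal.rpow_natCast, ENNReal.rpow_natCast,
    mul_pow, ENNReal.ofReal_pow ht]

/-- The Poincaré inequality on test functions with the constant given by `E_n(Ω)`. -/
lemma ofReal_mul_lintegral_le (hn : 2 ≤ n) (hΩ : volume (Ω : Set (Rn n)) < ⊤)
    (hE : moserTrudinger Ω ≠ ⊤) (φ : 𝓓(Ω, ℝ)) :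
    ENNReal.ofReal ((n : ℝ) ^ n * unitBallVolume n / ((n - 1).factorial : ℝ)) *
      (∫⁻ x in (Ω : Set (Rn n)), ‖φ x‖ₑ ^ (n : ℝ)) ≤
      moserTrudinger Ω * volume (Ω : Set (Rn n)) *
        ∫⁻ x in (Ω : Set (Rn n)), ‖gradient φ x‖ₑ ^ (n : ℝ) := by
  have hn0 : n ≠ 0 := by omega
  set I := ∫⁻ x in (Ω : Set (Rn n)), ‖φ x‖ₑ ^ (n : ℝ)
  set D := ∫⁻ x in (Ω : Set (Rn n)), ‖gradient φ x‖ₑ ^ (n : ℝ) with hD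
  set C := ENNReal.ofReal ((n : ℝ) ^ n * unitBallVolume n / ((n - 1).factorial : ℝ))
  set B := moserTrudinger Ω * volume (Ω : Set (Rn n)) with hB
  have hBT : B ≠ ⊤ := ENNReal.mul_ne_top hE hΩ.ne
  have hDT : D ≠ ⊤ := (lintegral_gradient_lt_top hn0 (contDiff_one φ) φ.hasCompactSupport _).ne
  have key : ∀ s : ℝ, 0 < s → ENNReal.ofReal s * D ≤ 1 → ENNReal.ofReal s * (C * I) ≤ B := by
    intro s hs hsD
    have ht : (s ^ ((n : ℝ)⁻¹)) ^ n = s := Real.rpow_inv_natCast_pow hs.le hn0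
    have ht0 : 0 ≤ s ^ ((n : ℝ)⁻¹) := by positivity
    have := ofReal_mul_lintegral_le_of_energy_le_one hn hΩ (s ^ ((n : ℝ)⁻¹) • φ)
      (by rw [energy_smul φ ht0, ht]; exact hsD)
    rw [lintegral_smul_pow φ ht0, ht] at this
    rwa [mul_left_comm]
  rw [mul_comm B]
  -- If the energy vanishes, arbitrarily large multiples of `φ` are admissible, which forces `C * I
  -- = 0`; otherwise scale by `s = 1 / D`.
  rcases eq_or_ne D 0 with h0 | h0
  · have h1 : ∀ m : ℕ, ENNReal.ofReal (m + 1) * (C * I) ≤ B := fun m =>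
      key _ (by positivity) (by simp [h0])
    rw [h0, zero_mul, nonpos_iff_eq_zero]
    by_contra hne
    have h2 : Filter.Tendsto (fun m : ℕ => ((m : ℝ≥0∞)) * (C * I)) Filter.atTop (nhds ⊤) := by
      have := ENNReal.Tendsto.mul_const (b := C * I) ENNReal.tendsto_nat_nhds_top (.inl (by simp))
      rwa [ENNReal.top_mul hne] at this
    refine hBT (top_le_iff.1 (le_of_tendsto' h2 fun m => le_trans ?_ (h1 m)))
    gcongr
    rw [← ENNReal.ofReal_natCast]
    exact ENNReal.ofReal_le_ofReal (by linarith)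
  · have hd : 0 < D.toReal := ENNReal.toReal_pos h0 hDT
    have e : ENNReal.ofReal D.toReal⁻¹ = D⁻¹ := by
      rw [ENNReal.ofReal_inv_of_pos hd, ENNReal.ofReal_toReal hDT]
    have h1 := key _ (inv_pos.2 hd) (by rw [e, ENNReal.inv_mul_cancel h0 hDT])
    rw [e] at h1
    calc C * I = D * (D⁻¹ * (C * I)) := by
          rw [← mul_assoc, ENNReal.mul_inv_cancel h0 hDT, one_mul]
      _ ≤ D * B := by gcongr

/-! ### From test functions to `W_0^{1,n}`. -/

lemma eLpNorm_natCast_eq (hn : n ≠ 0) {F : Type*} [NormedAddCommGroup F] (u : Rn n → F) :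
    eLpNorm u (ENNReal.ofReal n) (volume.restrict (Ω : Set (Rn n))) =
      (∫⁻ x in (Ω : Set (Rn n)), ‖u x‖ₑ ^ (n : ℝ)) ^ (1 / (n : ℝ)) := by
  rw [eLpNorm_eq_lintegral_rpow_enorm_toReal (by simpa using hn) (by simp)]
  simp

lemma eLpNorm_le_of_memW0 (hn : 2 ≤ n) {κ : ℝ≥0∞} (hκ : κ ≠ ⊤)
    (h : ∀ φ : 𝓓(Ω, ℝ), eLpNorm φ (ENNReal.ofReal n) (volume.restrict (Ω : Set (Rn n))) ≤
      κ * eLpNorm (gradient φ) (ENNReal.ofReal n) (volume.restrict (Ω : Set (Rn n))))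
    {f : Rn n → ℝ} {G : Rn n → Rn n} (hf : MemW0 n Ω f G) :
    eLpNorm f (ENNReal.ofReal n) (volume.restrict (Ω : Set (Rn n))) ≤
      κ * eLpNorm G (ENNReal.ofReal n) (volume.restrict (Ω : Set (Rn n))) := by
  set μ := volume.restrict (Ω : Set (Rn n))
  set p := ENNReal.ofReal n
  have hp : 1 ≤ p := by
    have : (1 : ℝ) ≤ n := by exact_mod_cast (by omega : 1 ≤ n)
    simpa [p] using this
  have step : ∀ ε : ℝ≥0∞, 0 < ε → eLpNorm f p μ ≤ ε + κ * (eLpNorm G p μ + ε) := by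
    intro ε hε
    obtain ⟨φ, hφ⟩ := hf.mem_closure ε hε
    have mφ : AEStronglyMeasurable (φ : Rn n → ℝ) μ := φ.continuous.aestronglyMeasurable
    have mg : AEStronglyMeasurable (gradient φ) μ :=
      (continuous_gradient (contDiff_one φ)).aestronglyMeasurable
    have h1 : eLpNorm f p μ ≤ eLpNorm (fun x => f x - φ x) p μ + eLpNorm φ p μ := by
      refine le_trans (le_of_eq ?_) (eLpNorm_add_le (hf.memLp.1.sub mφ) mφ hp)
      congr 1; ext x; simp
    have h2 : eLpNorm (gradient φ) p μ ≤
        eLpNorm G p μ + eLpNorm (fun x => G x - gradient φ x) p μ := by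
      refine le_trans (le_of_eq ?_) (eLpNorm_sub_le hf.memLp_grad.1 (hf.memLp_grad.1.sub mg) hp)
      congr 1; ext x; simp
    calc eLpNorm f p μ ≤ eLpNorm (fun x => f x - φ x) p μ + eLpNorm φ p μ := h1
      _ ≤ ε + κ * (eLpNorm G p μ + ε) := by
        refine add_le_add (le_self_add.trans hφ.le) ((h φ).trans ?_)
        gcongr
        exact h2.trans (by gcongr; exact le_add_self.trans hφ.le)
  have t : Filter.Tendsto (fun k : ℕ => (k : ℝ≥0∞)⁻¹ + κ * (eLpNorm G p μ + (k : ℝ≥0∞)⁻¹))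
      Filter.atTop (nhds (0 + κ * (eLpNorm G p μ + 0))) :=
    ENNReal.tendsto_inv_nat_nhds_zero.add (ENNReal.Tendsto.const_mul
      (tendsto_const_nhds.add ENNReal.tendsto_inv_nat_nhds_zero) (.inr hκ))
  rw [zero_add, add_zero] at t
  exact ge_of_tendsto' t fun k => step _ (by simp)

lemma one_le_moserTrudinger (hn : n ≠ 0) (hΩ0 : volume (Ω : Set (Rn n)) ≠ 0)
    (hΩ : volume (Ω : Set (Rn n)) < ⊤) : 1 ≤ moserTrudinger Ω := by
  have hg : gradient ((0 : 𝓓(Ω, ℝ)) : Rn n → ℝ) = 0 := by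
    have e : ((0 : 𝓓(Ω, ℝ)) : Rn n → ℝ) = fun _ => 0 := rfl
    ext1 x
    rw [e]
    simp [gradient]
  have hD : ∫⁻ x in (Ω : Set (Rn n)), ‖gradient ((0 : 𝓓(Ω, ℝ)) : Rn n → ℝ) x‖ₑ ^ (n : ℝ) ≤ 1 := by
    rw [hg]; simp [hn]
  refine le_trans ?_ (le_iSup₂ (0 : 𝓓(Ω, ℝ)) hD)
  calc (1 : ℝ≥0∞) = (volume (Ω : Set (Rn n)))⁻¹ * ∫⁻ x in (Ω : Set (Rn n)), 1 := by
        simp [ENNReal.inv_mul_cancel hΩ0 hΩ.ne]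
    _ ≤ _ := by
        gcongr with x
        rw [← ENNReal.ofReal_one]
        exact ENNReal.ofReal_le_ofReal (Real.one_le_exp (moserTrudinger_exponent_nonneg n _))

/-- The Faber–Krahn type inequality holds on every open set of finite volume. -/
theorem faberKrahnInequality (hn : 2 ≤ n) (hΩ0 : volume (Ω : Set (Rn n)) ≠ 0)
    (hΩ : volume (Ω : Set (Rn n)) < ⊤) : FaberKrahnInequality Ω := by
  have hn0 : n ≠ 0 := by omega
  have hnpos : (0 : ℝ) < n := by positivity
  have hE0 : moserTrudinger Ω ≠ 0 := (zero_lt_one.trans_le (one_le_moserTrudinger hn0 hΩ0 hΩ)).ne'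
  rcases eq_or_ne (moserTrudinger Ω) ⊤ with hE | hE
  · simp [FaberKrahnInequality, hE]
  rw [FaberKrahnInequality]
  set C := ENNReal.ofReal ((n : ℝ) ^ n * unitBallVolume n / ((n - 1).factorial : ℝ)) with hC
  have hC0 : C ≠ 0 := by
    have := mul_pos (by positivity : 0 < (n : ℝ) ^ n) (unitBallVolume_pos n)
    simp only [hC, ne_eq, ENNReal.ofReal_eq_zero, not_le]
    positivity
  have hCT : C ≠ ⊤ := ENNReal.ofReal_ne_top
  rw [mul_comm (principalEigenvalue _ _), ← ENNReal.div_le_iff' hΩ0 hΩ.ne]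
  refine le_iInf₂ fun f G => le_iInf₂ fun hf hne => ?_
  set B := moserTrudinger Ω * volume (Ω : Set (Rn n)) with hB
  have hBT : B ≠ ⊤ := ENNReal.mul_ne_top hE hΩ.ne
  have hroot : ∀ u : ℝ≥0∞, (u ^ (1 / (n : ℝ))) ^ (n : ℝ) = u := fun u => by
    rw [← ENNReal.rpow_mul, one_div_mul_cancel hnpos.ne', ENNReal.rpow_one]
  have h1 : ∀ φ : 𝓓(Ω, ℝ), eLpNorm φ (ENNReal.ofReal n) (volume.restrict (Ω : Set (Rn n))) ≤
      (B / C) ^ (1 / (n : ℝ)) *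
        eLpNorm (gradient φ) (ENNReal.ofReal n) (volume.restrict (Ω : Set (Rn n))) := by
    intro φ
    rw [eLpNorm_natCast_eq hn0, eLpNorm_natCast_eq hn0,
      ← ENNReal.mul_rpow_of_nonneg _ _ (by positivity)]
    refine ENNReal.rpow_le_rpow ?_ (by positivity)
    rw [← ENNReal.mul_div_right_comm, ENNReal.le_div_iff_mul_le (.inl hC0) (.inl hCT), mul_comm]
    exact ofReal_mul_lintegral_le hn hΩ hE φ
  have h2 := ENNReal.rpow_le_rpow (eLpNorm_le_of_memW0 hn
    (ENNReal.rpow_ne_top_of_nonneg (by positivity) (ENNReal.div_ne_top hBT hC0)) h1 hf) hnpos.le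
  rw [eLpNorm_natCast_eq hn0, eLpNorm_natCast_eq hn0, ENNReal.mul_rpow_of_nonneg _ _ hnpos.le,
    hroot, hroot, hroot, ← ENNReal.mul_div_right_comm,
    ENNReal.le_div_iff_mul_le (.inl hC0) (.inl hCT), mul_comm] at h2
  have hI0 : ∫⁻ x in (Ω : Set (Rn n)), ‖f x‖ₑ ^ (n : ℝ) ≠ 0 := by
    intro h0
    rw [lintegral_eq_zero_iff' (hf.memLp.1.enorm.pow_const _)] at h0
    refine hne (h0.mono fun x hx => ?_)
    simpa [hnpos, hn0] using hx
  have hIT : ∫⁻ x in (Ω : Set (Rn n)), ‖f x‖ₑ ^ (n : ℝ) ≠ ⊤ := by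
    have := lintegral_rpow_enorm_lt_top_of_eLpNorm_lt_top (by simpa using hn0) (by simp) hf.memLp.2
    simpa using this.ne
  rw [ENNReal.le_div_iff_mul_le (.inl hI0) (.inl hIT)]
  refine le_trans (le_of_eq ?_) (ENNReal.div_le_of_le_mul' h2)
  rw [hB, ENNReal.div_eq_inv_mul, ENNReal.div_eq_inv_mul,
    ENNReal.mul_inv (.inl hE0) (.inl hE)]
  ring

/-! ### The Moser–Trudinger inequality -/

/-! ### Real inequalities behind Moser's lemma. -/

lemma one_add_four_mul_pow_le {z : ℝ} (hz : 0 ≤ z) (hz1 : z ≤ 1) (m : ℕ) :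
    (1 + 4 * z) ^ m ≤ 1 + (5 ^ m - 1) * z := by
  induction m with
  | zero => simp
  | succ m ih =>
    have h5 : (1 : ℝ) ≤ 5 ^ m := one_le_pow₀ (by norm_num)
    calc (1 + 4 * z) ^ (m + 1) = (1 + 4 * z) ^ m * (1 + 4 * z) := pow_succ _ _
      _ ≤ (1 + (5 ^ m - 1) * z) * (1 + 4 * z) := by gcongr
      _ ≤ 1 + (5 ^ (m + 1) - 1) * z := by
        rw [pow_succ]
        nlinarith [mul_nonneg (mul_nonneg (sub_nonneg.2 h5) hz) (sub_nonneg.2 hz1)]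

/-- Convexity of the power, with weights `θ`, `1 - θ` at the points `a / θ` and `(b - a) / (1 - θ)`.
-/
lemma pow_le_div_pow_add_div_pow {a b θ : ℝ} (ha : 0 ≤ a) (hab : a ≤ b) (hθ : 0 < θ) (hθ1 : θ < 1)
    (m : ℕ) : b ^ (m + 1) ≤ a ^ (m + 1) / θ ^ m + (b - a) ^ (m + 1) / (1 - θ) ^ m := by
  have h1 : 0 < 1 - θ := by linarith
  have h := (convexOn_pow (𝕜 := ℝ) (m + 1)).2 (x := a / θ) (y := (b - a) / (1 - θ))
    (div_nonneg ha hθ.le) (div_nonneg (sub_nonneg.2 hab) h1.le) hθ.le h1.le (by ring)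
  simp only [smul_eq_mul] at h
  have e : θ * (a / θ) + (1 - θ) * ((b - a) / (1 - θ)) = b := by field_simp; ring
  rw [e] at h
  refine h.trans (le_of_eq ?_)
  rw [div_pow, div_pow, pow_succ θ, pow_succ (1 - θ)]
  field_simp

/-- The core of Moser's one-dimensional lemma: the times at which the level is almost extremal
cannot be far apart. -/
lemma almost_extremal_gap {m K : ℕ} (hm : 1 ≤ m) (hK : 4 ≤ K) (hKm : 2 * (m * 5 ^ m) ≤ K)
    {c a b δ l σ τ : ℝ} (hc : 0 < c) (ha : 0 ≤ a) (hab : a ≤ b) (hδ1 : δ ≤ 1)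
    (hl : 0 < l) (hσ : K * l < σ) (hτ : K * l < τ)
    (h1 : c * a ^ (m + 1) ≤ δ * σ ^ m) (h2 : c * (b - a) ^ (m + 1) ≤ (1 - δ) * τ ^ m)
    (h3 : (σ - l) ^ m ≤ c * a ^ (m + 1)) (h4 : (σ + τ - l) ^ m ≤ c * b ^ (m + 1)) : False := by
  have hK' : (4 : ℝ) ≤ K := by exact_mod_cast hK
  have hKm' : 2 * (m * 5 ^ m) ≤ (K : ℝ) := by exact_mod_cast hKm
  have hm' : (1 : ℝ) ≤ m := by exact_mod_cast hm
  have hσ4 : 4 * l < σ := by nlinarith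
  have hτ4 : 4 * l < τ := by nlinarith
  have hσ0 : 0 < σ := by linarith
  have hτ0 : 0 < τ := by linarith
  have hR : 0 < σ + τ - 2 * l := by linarith
  have hτ2 : 0 < τ - 2 * l := by linarith
  -- The total `R` lies `l` below `σ + τ - l`, so `h4` exceeds `R ^ m` by a relative amount of first
  -- order, `m * (l / R)`. The upper bound from convexity, with weights `σ / R` and `(τ - 2 * l) /
  -- R`, exceeds it only by order `l² / (σ * τ)`. For `σ` and `τ` larger than `K * l` these are
  -- incompatible.
  set R := σ + τ - 2 * l with hRdef
  have hθ0 : 0 < σ / R := by positivity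
  have hθ1 : σ / R < 1 := by rw [div_lt_one hR]; linarith
  have e1 : 1 - σ / R = (τ - 2 * l) / R := by field_simp; linarith
  have hJ := pow_le_div_pow_add_div_pow ha hab hθ0 hθ1 m
  set z := l / τ with hz
  have hz0 : 0 < z := by positivity
  have hz4 : z < 1 / 4 := by rw [hz, div_lt_iff₀ hτ0]; linarith
  have hq : τ / (τ - 2 * l) ≤ 1 + 4 * z := by
    have hlz : l = z * τ := by rw [hz]; field_simp
    rw [div_le_iff₀ hτ2, hlz]
    nlinarith [mul_nonneg (mul_nonneg hz0.le hτ0.le) (sub_nonneg.2 hz4.le)]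
  have hqm : (τ / (τ - 2 * l)) ^ m ≤ 1 + 5 ^ m * z :=
    (pow_le_pow_left₀ (by positivity) hq m).trans
      ((one_add_four_mul_pow_le hz0.le (by linarith) m).trans (by nlinarith))
  -- Near-extremality at `σ` means that almost all the energy is already spent there.
  have hδ : 1 - δ ≤ m * (l / σ) := by
    have h := h3.trans h1
    have e : (σ - l) ^ m = (1 + -(l / σ)) ^ m * σ ^ m := by
      rw [← mul_pow]; congr 1; field_simp; ring
    rw [e] at h
    have h' := le_of_mul_le_mul_right h (by positivity)
    have hls : l / σ ≤ 1 := by rw [div_le_one hσ0]; linarith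
    have := one_add_mul_le_pow (a := -(l / σ)) (by linarith) m
    linarith
  have hb1 : c * b ^ (m + 1) ≤ R ^ m * (δ + (1 - δ) * (τ / (τ - 2 * l)) ^ m) := by
    calc c * b ^ (m + 1)
        ≤ c * (a ^ (m + 1) / (σ / R) ^ m + (b - a) ^ (m + 1) / ((τ - 2 * l) / R) ^ m) := by
          rw [← e1]; gcongr
      _ = c * a ^ (m + 1) / (σ / R) ^ m + c * (b - a) ^ (m + 1) / ((τ - 2 * l) / R) ^ m := by ring
      _ ≤ δ * σ ^ m / (σ / R) ^ m + (1 - δ) * τ ^ m / ((τ - 2 * l) / R) ^ m := by gcongr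
      _ = _ := by
          simp only [div_pow]
          field_simp
  have hb2 : δ + (1 - δ) * (τ / (τ - 2 * l)) ^ m ≤ 1 + m * (l / σ) * (5 ^ m * z) := by
    have hδ0 : 0 ≤ 1 - δ := by linarith
    calc δ + (1 - δ) * (τ / (τ - 2 * l)) ^ m ≤ δ + (1 - δ) * (1 + 5 ^ m * z) := by gcongr
      _ = 1 + (1 - δ) * (5 ^ m * z) := by ring
      _ ≤ _ := by gcongr
  have hlow : R ^ m * (1 + m * (l / R)) ≤ (σ + τ - l) ^ m := by
    have e : (σ + τ - l) ^ m = R ^ m * (1 + l / R) ^ m := by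
      rw [← mul_pow]; congr 1; rw [mul_add, mul_div_cancel₀ _ hR.ne', hRdef]; ring
    rw [e]
    have : 0 < l / R := by positivity
    gcongr
    exact one_add_mul_le_pow (by linarith) m
  have hfin : 1 + m * (l / R) ≤ 1 + m * (l / σ) * (5 ^ m * z) := by
    have := hlow.trans (h4.trans (hb1.trans (mul_le_mul_of_nonneg_left hb2 (by positivity))))
    exact le_of_mul_le_mul_left this (by positivity)
  have h5 : l / R ≤ m * (l / σ) * (5 ^ m * z) := by
    have : l / R ≤ m * (l / R) := le_mul_of_one_le_left (by positivity) hm'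
    linarith
  have h6 : σ * τ ≤ m * 5 ^ m * l * R := by
    rw [hz, div_le_iff₀ hR] at h5
    have : l * (σ * τ) ≤ l * (m * 5 ^ m * l * R) := by
      calc l * (σ * τ) ≤ (m * (l / σ) * (5 ^ m * (l / τ)) * R) * (σ * τ) := by gcongr
        _ = _ := by field_simp
    exact le_of_mul_le_mul_left this hl
  have h7 : 2 * (m * 5 ^ m * l * R) ≤ K * l * (σ + τ) := by
    calc 2 * (m * 5 ^ m * l * R) = 2 * (m * 5 ^ m) * (l * R) := by ring
      _ ≤ K * (l * (σ + τ)) := by gcongr; linarith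
      _ = _ := by ring
  nlinarith [mul_lt_mul_of_pos_right hσ hτ0, mul_lt_mul_of_pos_right hτ hσ0]

/-- Beyond `N`, all indices lie in one window of length `N + 1` starting at the least of them. -/
lemma exists_finset_of_gap {J : Set ℕ} {N : ℕ}
    (h : ∀ i ∈ J, ∀ j ∈ J, N < i → i ≤ j → j ≤ i + N) :
    ∃ F : Finset ℕ, J ⊆ F ∧ F.card ≤ 2 * (N + 1) := by
  classical
  by_cases hne : ∃ i, i ∈ J ∧ N < i
  · obtain ⟨hi, hiN⟩ := Nat.find_spec hne
    refine ⟨Finset.range (N + 1) ∪ Finset.Icc (Nat.find hne) (Nat.find hne + N), fun j hj => ?_, ?_⟩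
    · rcases le_or_gt j N with hjN | hjN
      · simp [Nat.lt_succ_of_le hjN]
      · have h1 := Nat.find_min' hne ⟨hj, hjN⟩
        simp [h1, h _ hi _ hj hiN h1]
    · refine (Finset.card_union_le _ _).trans ?_
      simp only [Finset.card_range, Nat.card_Icc]
      omega
  · push Not at hne
    exact ⟨Finset.range (N + 1), fun j hj => by simpa using Nat.lt_succ_of_le (hne j hj),
      by simp⟩

lemma volume_low_level_le {f : Rn n → ℝ} (hf : Continuous f) (hc : HasCompactSupport f) {η : ℝ}
    (hη : 0 ≤ η) :
    volume {x | f x ≠ 0 ∧ closedLevelVolume f |f x| ≤ η} ≤ ENNReal.ofReal η := by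
  have hanti : Antitone fun t : ℝ => volume {w | t ≤ |f w|} :=
    fun s t hst => measure_mono fun w hw => hst.trans hw
  have e : {x | f x ≠ 0 ∧ closedLevelVolume f |f x| ≤ η} =
      {x | f x ≠ 0} ∩ {x | volume {w | |f x| ≤ |f w|} ≤ ENNReal.ofReal η} := by
    ext x
    refine and_congr_right fun hx => ?_
    exact (ENNReal.le_ofReal_iff_toReal_le (volume_le_abs_lt_top hc (abs_pos.2 hx)).ne hη).symm
  rw [e]
  refine volume_le_of_forall_volume_superlevel_le hf ?_ fun z hz => hz.2
  exact (hf.measurable (measurableSet_singleton 0).compl).inter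
    (measurableSet_le (hanti.measurable.comp hf.abs.measurable) measurable_const)

/-- In the application, `k` records the deficit `s - g` and `j` the value of `s`. The factors `e^j`
and `e^(-j)` cancel, so a band contributes `V e^(1-k)` whatever `j` is, and the gap condition leaves
at most `2 (N k + 1)` nonempty bands for each `k`. -/
lemma lintegral_le_tsum_of_bands {g : Rn n → ℝ} {T : ℕ → ℕ → Set (Rn n)} {V : ℝ} {N : ℕ → ℕ}
    (hV : 0 ≤ V)
    (hvol : ∀ k j, volume (T k j) ≤ ENNReal.ofReal (V * Real.exp (-j)))
    (hg : ∀ k j, ∀ x ∈ T k j, g x ≤ j + 1 - k)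
    (hgap : ∀ k, ∀ i j, (T k i).Nonempty → (T k j).Nonempty → N k < i → i ≤ j → j ≤ i + N k) :
    ∫⁻ x in ⋃ k, ⋃ j, T k j, ENNReal.ofReal (Real.exp (g x)) ≤
      ENNReal.ofReal V * ∑' k : ℕ, ENNReal.ofReal (2 * (N k + 1) * Real.exp (1 - k)) := by
  rw [← ENNReal.tsum_mul_left]
  refine (lintegral_iUnion_le _ _).trans (ENNReal.tsum_le_tsum fun k => ?_)
  have hband : ∀ j, ∫⁻ x in T k j, ENNReal.ofReal (Real.exp (g x)) ≤
      ENNReal.ofReal (V * Real.exp (1 - k)) := by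
    intro j
    calc ∫⁻ x in T k j, ENNReal.ofReal (Real.exp (g x))
        ≤ ∫⁻ _ in T k j, ENNReal.ofReal (Real.exp (j + 1 - k)) :=
          setLIntegral_mono measurable_const fun x hx =>
            ENNReal.ofReal_le_ofReal (Real.exp_le_exp.2 (hg k j x hx))
      _ = ENNReal.ofReal (Real.exp (j + 1 - k)) * volume (T k j) := by simp
      _ ≤ ENNReal.ofReal (Real.exp (j + 1 - k)) * ENNReal.ofReal (V * Real.exp (-j)) := by
          gcongr; exact hvol k j
      _ = ENNReal.ofReal (V * Real.exp (1 - k)) := by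
          rw [← ENNReal.ofReal_mul (by positivity), mul_left_comm, ← Real.exp_add]
          congr 3; ring
  obtain ⟨F, hJF, hF⟩ := exists_finset_of_gap (J := {j | (T k j).Nonempty}) (N := N k)
    fun i hi j hj => hgap k i j hi hj
  calc ∫⁻ x in ⋃ j, T k j, ENNReal.ofReal (Real.exp (g x))
      ≤ ∑' j, ∫⁻ x in T k j, ENNReal.ofReal (Real.exp (g x)) := lintegral_iUnion_le _ _
    _ = ∑ j ∈ F, ∫⁻ x in T k j, ENNReal.ofReal (Real.exp (g x)) := by
        refine tsum_eq_sum fun j hj => ?_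
        have : T k j = ∅ := Set.not_nonempty_iff_eq_empty.1 fun h => hj (hJF h)
        simp [this]
    _ ≤ ∑ j ∈ F, ENNReal.ofReal (V * Real.exp (1 - k)) := Finset.sum_le_sum fun j _ => hband j
    _ = F.card * ENNReal.ofReal (V * Real.exp (1 - k)) := by simp
    _ ≤ ((2 * (N k + 1) : ℕ) : ℝ≥0∞) * ENNReal.ofReal (V * Real.exp (1 - k)) := by gcongr
    _ = _ := by
        rw [← ENNReal.ofReal_natCast, ← ENNReal.ofReal_mul (by positivity),
          ← ENNReal.ofReal_mul hV]
        congr 1; push_cast; ring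

/-- Moser's inequality with the constant made explicit as a series. -/
lemma lintegral_exp_le (hn : 2 ≤ n) (hΩ : volume (Ω : Set (Rn n)) < ⊤) {K : ℕ} (hK : 4 ≤ K)
    (hKn : 2 * ((n - 1) * 5 ^ (n - 1)) ≤ K) (φ : 𝓓(Ω, ℝ))
    (hφ : ∫⁻ x in (Ω : Set (Rn n)), ‖gradient φ x‖ₑ ^ (n : ℝ) ≤ 1) :
    ∫⁻ x in (Ω : Set (Rn n)), ENNReal.ofReal
      (Real.exp (|φ x| ^ ((n : ℝ) / ((n : ℝ) - 1)) /
        ((n : ℝ) ^ n * unitBallVolume n) ^ (1 / (1 - (n : ℝ))))) ≤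
      volume (Ω : Set (Rn n)) * (1 + ∑' k : ℕ,
        ENNReal.ofReal (2 * ((K * (k + 1) : ℕ) + 1) * Real.exp (1 - k))) := by
  have hn0 : n ≠ 0 := by omega
  have hm1 : n - 1 + 1 = n := by omega
  have hm0 : n - 1 ≠ 0 := by omega
  set A : ℝ → ℝ := fun t => |t| ^ ((n : ℝ) / ((n : ℝ) - 1)) /
        ((n : ℝ) ^ n * unitBallVolume n) ^ (1 / (1 - (n : ℝ))) with hA
  set c := (n : ℝ) ^ n * unitBallVolume n with hc
  have hc0 : 0 < c := mul_pos (by positivity) (unitBallVolume_pos n)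
  have hA0 : ∀ t, 0 ≤ A t := moserTrudinger_exponent_nonneg n
  have hAp : ∀ t, A t ^ (n - 1) = c * |t| ^ n := moserTrudinger_exponent_pow hn
  have hf := contDiff_one φ
  have hcs := φ.hasCompactSupport
  set V := volume.real (Ω : Set (Rn n)) with hV
  set m : Rn n → ℝ := fun x => closedLevelVolume φ |φ x| with hm
  set s : Rn n → ℝ := fun x => Real.log (V / m x) with hs
  have hmV : ∀ x, φ x ≠ 0 → m x ≤ V := fun x hx => measureReal_mono
    (fun z hz => support_subset φ (abs_pos.1 ((abs_pos.2 hx).trans_le hz))) hΩ.ne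
  have hE : ∀ b, ringEnergy φ 0 b ≤ 1 := fun b => by
    have := (ofReal_ringEnergy_le hn0 φ le_rfl b).trans hφ
    simpa using this
  have hring0 : ∀ x, φ x ≠ 0 → 0 < m x →
      c * |φ x| ^ n ≤ ringEnergy φ 0 |φ x| * s x ^ (n - 1) := by
    intro x hx hmx
    have := mul_pow_le_ringEnergy_mul_log_pow hn hf hcs le_rfl (abs_nonneg (φ x)) hmx
      (X := V / m x) ((one_le_div hmx).2 (hmV x hx))
      (by rw [div_mul_cancel₀ _ hmx.ne']; exact openLevelVolume_zero_le hΩ φ)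
    simpa using this
  have hs0 : ∀ x, φ x ≠ 0 → 0 < m x → 0 ≤ s x := fun x hx hmx =>
    Real.log_nonneg ((one_le_div hmx).2 (hmV x hx))
  have hF0 : ∀ x, φ x ≠ 0 → 0 < m x → A (φ x) ≤ s x := by
    intro x hx hmx
    refine le_of_pow_le_pow_left₀ hm0 (hs0 x hx hmx) ?_
    rw [hAp]
    refine (hring0 x hx hmx).trans ?_
    exact mul_le_of_le_one_left (pow_nonneg (hs0 x hx hmx) _) (hE _)
  -- The energy spent below `|φ x|` plays the role of `δ`; what remains, at most `1 - δ`, bounds the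
  -- ring between `|φ x|` and `|φ y|`.
  have hgap : ∀ x y l, φ x ≠ 0 → 0 < m x → φ y ≠ 0 → 0 < m y → 0 < l → K * l < s x →
      K * l < s y - s x → s x - A (φ x) ≤ l → s y - A (φ y) ≤ l → False := by
    intro x y l hx hmx hy hmy hl hsx hsy hFx hFy
    have hKl : l ≤ K * l := le_mul_of_one_le_left hl.le (by exact_mod_cast (by omega : 1 ≤ K))
    have hV0 : 0 < V := hmx.trans_le (hmV x hx)
    have hτ : Real.log (m x / m y) = s y - s x := by
      simp only [hs]
      rw [Real.log_div hV0.ne' hmx.ne', Real.log_div hV0.ne' hmy.ne',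
        Real.log_div hmx.ne' hmy.ne']
      ring
    have hmyx : m y < m x := by
      by_contra! h
      have : Real.log (m x / m y) ≤ 0 :=
        Real.log_nonpos (by positivity) ((div_le_one hmy).2 h)
      nlinarith
    have hab : |φ x| < |φ y| := by
      by_contra! h
      exact hmyx.not_ge (measureReal_mono (fun z hz => h.trans hz)
        (volume_le_abs_lt_top hcs (abs_pos.2 hy)).ne)
    have h2 := mul_pow_le_ringEnergy_mul_log_pow hn hf hcs (abs_nonneg (φ x)) hab.le hmy
      (X := m x / m y) ((one_le_div hmy).2 hmyx.le)
      (by rw [div_mul_cancel₀ _ hmy.ne']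
          exact openLevelVolume_le_closedLevelVolume hcs (abs_pos.2 hx))
    rw [hτ] at h2
    have hE2 := (ringEnergy_add_le hn0 hf hcs (abs_nonneg (φ x)) hab.le).trans (hE _)
    refine almost_extremal_gap (m := n - 1) (by omega) hK hKn hc0 (abs_nonneg (φ x)) hab.le
      (hE |φ x|) hl hsx hsy ?_ ?_ ?_ ?_ <;> rw [hm1]
    · exact hring0 x hx hmx
    · refine h2.trans ?_
      have : 0 ≤ s y - s x := by nlinarith
      gcongr
      linarith
    · rw [← hAp]
      exact pow_le_pow_left₀ (by linarith) (by linarith) _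
    · rw [← hAp]
      exact pow_le_pow_left₀ (by linarith) (by linarith) _
  set T : ℕ → ℕ → Set (Rn n) := fun k j => {x | (φ x ≠ 0 ∧ 0 < m x) ∧
    ((k : ℝ) ≤ s x - A (φ x) ∧ s x - A (φ x) < k + 1) ∧ ((j : ℝ) ≤ s x ∧ s x < j + 1)} with hT
  have hbands := lintegral_le_tsum_of_bands (g := fun x => A (φ x)) (T := T) (V := V)
    (N := fun k => K * (k + 1)) measureReal_nonneg ?_ ?_ ?_
  -- The zero set of `φ` contributes at most the volume of `Ω`, the `1` in the constant; points
  -- whose closed superlevel set is null form a null set; the bands cover the rest.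
  · have hcover : (Ω : Set (Rn n)) ⊆ ((Ω : Set (Rn n)) ∩ {x | φ x = 0}) ∪
        ({x | φ x ≠ 0 ∧ closedLevelVolume φ |φ x| ≤ 0} ∪ ⋃ k, ⋃ j, T k j) := by
      intro x hx
      by_cases h0 : φ x = 0
      · exact Or.inl ⟨hx, h0⟩
      · rcases le_or_gt (m x) 0 with h1 | h1
        · exact Or.inr (Or.inl ⟨h0, h1⟩)
        · refine Or.inr (Or.inr (Set.mem_iUnion₂.2 ⟨⌊s x - A (φ x)⌋₊, ⌊s x⌋₊, ⟨h0, h1⟩,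
            ⟨?_, ?_⟩, ⟨?_, ?_⟩⟩))
          · exact Nat.floor_le (sub_nonneg.2 (hF0 x h0 h1))
          · exact Nat.lt_floor_add_one _
          · exact Nat.floor_le (hs0 x h0 h1)
          · exact Nat.lt_floor_add_one _
    have hnull : volume {x | φ x ≠ 0 ∧ closedLevelVolume φ |φ x| ≤ 0} = 0 :=
      le_antisymm (by simpa using volume_low_level_le φ.continuous hcs (le_refl (0 : ℝ))) zero_le
    have hzero : ∫⁻ x in (Ω : Set (Rn n)) ∩ {x | φ x = 0},
        ENNReal.ofReal (Real.exp (A (φ x))) ≤ volume (Ω : Set (Rn n)) := by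
      calc _ ≤ ∫⁻ _ in (Ω : Set (Rn n)) ∩ {x | φ x = 0}, 1 := by
            refine setLIntegral_mono measurable_const fun x hx => ?_
            have h0 : φ x = 0 := hx.2
            have : A 0 = 0 := by
              refine pow_eq_zero_iff hm0 |>.1 ?_
              rw [hAp]; simp [hn0]
            simp [h0, this]
        _ ≤ _ := by
            simp only [lintegral_const, Measure.restrict_apply MeasurableSet.univ,
              Set.univ_inter, one_mul]
            exact measure_mono Set.inter_subset_left
    refine (lintegral_mono_set hcover).trans ?_
    refine (lintegral_union_le _ _ _).trans ?_
    rw [mul_add, mul_one]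
    refine add_le_add hzero ((lintegral_union_le _ _ _).trans ?_)
    rw [Measure.restrict_zero_set hnull, lintegral_zero_measure, zero_add]
    rw [hV, ofReal_measureReal hΩ.ne] at hbands
    exact hbands
  · rintro k j
    refine (measure_mono ?_).trans (volume_low_level_le φ.continuous hcs
      (mul_nonneg measureReal_nonneg (Real.exp_pos _).le))
    rintro x ⟨⟨h0, h1⟩, -, h2, -⟩
    refine ⟨h0, ?_⟩
    have hV0 : 0 < V := h1.trans_le (hmV x h0)
    have h3 := Real.exp_le_exp.2 h2
    simp only [hs] at h3
    rw [Real.exp_log (by positivity), le_div_iff₀ h1] at h3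
    rw [Real.exp_neg, ← div_eq_mul_inv, le_div_iff₀ (Real.exp_pos _), mul_comm]
    exact h3
  · rintro k j x ⟨-, ⟨h1, -⟩, -, h2⟩
    linarith
  · rintro k i j ⟨x, ⟨hx0, hx1⟩, ⟨-, hx2⟩, hx3, hx4⟩ ⟨y, ⟨hy0, hy1⟩, ⟨-, hy2⟩, hy3, -⟩ hi hij
    by_contra! hlt
    -- The slack is `l = k + 1`, the upper end of the deficit band. The `+ 1` from the strict
    -- inequality of integers absorbs the unit width of the bands of `s`.
    have h1 : ((K * (k + 1) : ℕ) : ℝ) + 1 ≤ i := by exact_mod_cast hi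
    have h2 : (i : ℝ) + (K * (k + 1) : ℕ) + 1 ≤ j := by exact_mod_cast hlt
    push_cast at h1 h2
    exact hgap x y (k + 1) hx0 hx1 hy0 hy1 (by positivity) (by linarith) (by linarith) hx2.le hy2.le

/-- The Moser–Trudinger inequality. -/
theorem moserTrudinger_lt_top (hn : 2 ≤ n) (hΩ0 : volume (Ω : Set (Rn n)) ≠ 0)
    (hΩ : volume (Ω : Set (Rn n)) < ⊤) : moserTrudinger Ω < ⊤ := by
  set K := 4 + 2 * ((n - 1) * 5 ^ (n - 1)) with hK
  have hsum : Summable fun k : ℕ => 2 * (((K * (k + 1) : ℕ) : ℝ) + 1) * Real.exp (1 - k) := by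
    have h1 := Real.summable_pow_mul_exp_neg_nat_mul 1 one_pos
    have h0 := Real.summable_pow_mul_exp_neg_nat_mul 0 one_pos
    refine ((h1.mul_left (2 * K * Real.exp 1)).add (h0.mul_left (2 * (K + 1) * Real.exp 1))).congr
      fun k => ?_
    rw [Real.exp_sub, div_eq_mul_inv, ← Real.exp_neg]
    push_cast
    simp only [neg_one_mul, pow_one, pow_zero]
    ring
  refine lt_of_le_of_lt (iSup₂_le fun φ hφ => ?_) (ENNReal.add_lt_top.2
    ⟨ENNReal.one_lt_top, hsum.tsum_ofReal_lt_top⟩)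
  refine (mul_le_mul_right (lintegral_exp_le hn hΩ (K := K) (by omega) (by omega) φ hφ) _).trans
    (le_of_eq ?_)
  rw [← mul_assoc, ENNReal.inv_mul_cancel hΩ0 hΩ.ne, one_mul]

end TestFunctions

end FaberKrahn

end

/-! ### Conclusion. -/

theorem proposition3p3 (n : ℕ) (hn : 2 ≤ n) (Ω : TopologicalSpace.Opens (FaberKrahn.Rn n))
    (hne : (Ω : Set (FaberKrahn.Rn n)).Nonempty) (hΩ : Ω ∈ FaberKrahn.AC ⊤) :
    (FaberKrahn.CapacityVolumeInequality Ω ↔ FaberKrahn.moserTrudinger Ω < ⊤) ∧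
    (FaberKrahn.CapacityVolumeInequality Ω → FaberKrahn.FaberKrahnInequality Ω) ∧
    (FaberKrahn.moserTrudinger Ω < ⊤ → FaberKrahn.FaberKrahnInequality Ω) := by
  have h0 : volume (Ω : Set (FaberKrahn.Rn n)) ≠ 0 := (Ω.isOpen.measure_pos volume hne).ne'
  have hT := FaberKrahn.volume_lt_top_of_mem_AC hΩ
  have hFK := FaberKrahn.faberKrahnInequality hn h0 hT
  exact ⟨⟨fun _ => FaberKrahn.moserTrudinger_lt_top hn h0 hT,
    fun _ => FaberKrahn.capacityVolumeInequality hn hT⟩, fun _ => hFK, fun _ => hFK⟩
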